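/- Let $X$ be a compact connected Riemann surface and $D\subset X$ a nonempty finite subset, regarded as a reduced effective divisor. Let $G$ be a connected complex reductive affine algebraic group with Lie algebra $\mathfrak g$, let $\sigma$ be a nondegenerate symmetric $G$-invariant bilinear form on $\mathfrak g$, and for each $x\in D$ let $H_x\subsetneq G$ be a Zariski closed proper subgroup with Lie algebra $\mathfrak h_x$. Let $E_G\to X$ be a holomorphic principal $G$-bundle with a framing $\phi$ over $D$, that is, a point $\phi(x)\in (E_G)_x/H_x$ for every $x\in D$. Let $\mathrm{ad}(E_G)=E_G\times^G\mathfrak g$ be the adjoint bundle, whose fiber at $x$ is the space of maps $v:(E_G)_x\to\mathfrak g$ with $v(zg)=\mathrm{Ad}(g^{-1})v(z)$, and let $\widehat\sigma$ be the fiberwise nondegenerate symmetric form on $\mathrm{ad}(E_G)$ induced by $\sigma$. For $x\in D$ let $\mathcal H_x\subset \mathrm{ad}(E_G)_x$ be the subspace of those $v$ with $v(z)\in\mathfrak h_x$ for all $z$ in the $H_x$-orbit $\phi(x)\subset (E_G)_x$, and let $\mathcal H_x^\perp\subset\mathrm{ad}(E_G)_x$ be its annihilator for $\widehat\sigma(x)$.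 Let $\mathrm{ad}_\phi(E_G)$ (respectively $\mathrm{ad}^n_\phi(E_G)$) be the subsheaf of the sheaf of holomorphic sections of $\mathrm{ad}(E_G)$ given by the sections $s$ with $s(x)\in\mathcal H_x$ (respectively $s(x)\in\mathcal H_x^\perp$) for every $x\in D$ in the domain of $s$. Write $M^*=\mathcal Hom_{\mathcal O_X}(M,\mathcal O_X)$ for a sheaf $M$ of $\mathcal O_X$-modules. 1. There is a unique isomorphism of $\mathcal O_X$-modules $$S:\ \mathrm{ad}^n_\phi(E_G)\otimes\mathcal O_X(D)\ \xrightarrow{\ \sim\ }\ \mathrm{ad}_\phi(E_G)^*$$ that is induced by $\widehat\sigma$, in the sense that $S(s\otimes f)(t)=f\,\widehat\sigma(s,t)$ on the complement of $D$, for all local sections $s$ of $\mathrm{ad}^n_\phi(E_G)$, $f$ of $\mathcal O_X(D)$ and $t$ of $\mathrm{ad}_\phi(E_G)$. In particular, this identification depends only on $\sigma$. 2. There is likewise a unique isomorphism of $\mathcal O_X$-modules $$S':\ \mathrm{ad}_\phi(E_G)\otimes\mathcal O_X(D)\ \xrightarrow{\ \sim\ }\ \mathrm{ad}^n_\phi(E_G)^*$$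 with $S'(s\otimes f)(t)=f\,\widehat\sigma(s,t)$ on the complement of $D$, for all local sections $s$ of $\mathrm{ad}_\phi(E_G)$, $f$ of $\mathcal O_X(D)$ and $t$ of $\mathrm{ad}^n_\phi(E_G)$. -/

import Mathlib

open CategoryTheory TopologicalSpace Opposite
open scoped ContDiff Manifold

noncomputable section

namespace FramedBundle

section Sheaves

variable (X : Type) [TopologicalSpace X] [ChartedSpace ℂ X]

/-- The sheaf of rings `𝒪_X` of holomorphic functions (for a complex manifold, functions
that are `C^∞` over `ℂ` are exactly the holomorphic functions). -/
abbrev structureSheaf : TopCat.Sheaf CommRingCat.{0} (TopCat.of X) :=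
  smoothSheafCommRing 𝓘(ℂ, ℂ) 𝓘(ℂ, ℂ) X ℂ

/-- `𝒪_X` as a sheaf of (not necessarily commutative) rings. -/
abbrev ringSheaf : TopCat.Sheaf RingCat.{0} (TopCat.of X) where
  obj := (structureSheaf X).obj ⋙ forget₂ CommRingCat RingCat
  property := ((sheafCompose _ (forget₂ CommRingCat RingCat)).obj (structureSheaf X)).property

/-- The category of sheaves of `𝒪_X`-modules. -/
abbrev OMod : Type 1 := SheafOfModules.{0} (ringSheaf X)

variable {X}

/-- The ring `𝒪_X(U)`. -/
abbrev holFun (U : Opens X) : Type := C^∞⟮𝓘(ℂ, ℂ), U; 𝓘(ℂ, ℂ), ℂ⟯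

/-- Restriction of holomorphic functions. -/
abbrev holRes {U V : Opens X} (h : V ≤ U) : holFun U →+* holFun V :=
  ContMDiffMap.restrictRingHom 𝓘(ℂ, ℂ) 𝓘(ℂ, ℂ) ℂ h

/-- A local condition on families of vectors `s x ∈ T x`, `x ∈ U`, closed under addition and
under multiplication by holomorphic functions. -/
structure ModulePredicate (T : X → Type) [∀ x, AddCommGroup (T x)] [∀ x, Module ℂ (T x)]
    extends TopCat.LocalPredicate (X := TopCat.of X) T where
  zero_mem : ∀ U : Opens X, pred (U := U) (fun _ => 0)
  add_mem : ∀ {U : Opens X} {s t : ∀ x : U, T x}, pred (U := U) s → pred (U := U) t →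
    pred (U := U) (fun x => s x + t x)
  smul_mem : ∀ {U : Opens X} (f : holFun U) {s : ∀ x : U, T x}, pred (U := U) s →
    pred (U := U) (fun x => f x • s x)

namespace ModulePredicate

variable {T : X → Type} [∀ x, AddCommGroup (T x)] [∀ x, Module ℂ (T x)]
  (P : ModulePredicate T)

/-- The sections over `U`: the families that satisfy the condition. -/
def sections (U : Opens X) : AddSubgroup (∀ x : U, T x) where
  carrier := {s | P.pred (U := U) s}
  zero_mem' := P.zero_mem U
  add_mem' := P.add_mem
  neg_mem' {s} hs := by
    have := P.smul_mem (U := U) (-1) hs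
    simpa [Pi.neg_def] using this

instance (U : Opens X) : Module (holFun U) (P.sections U) where
  smul f s := ⟨fun x => f x • s.1 x, P.smul_mem f s.2⟩
  one_smul s := Subtype.ext <| funext fun x => one_smul ℂ (s.1 x)
  mul_smul f g s := Subtype.ext <| funext fun x => mul_smul (f x) (g x) (s.1 x)
  smul_zero f := Subtype.ext <| funext fun x => smul_zero (f x)
  smul_add f s t := Subtype.ext <| funext fun x => smul_add (f x) (s.1 x) (t.1 x)
  add_smul f g s := Subtype.ext <| funext fun x => add_smul (f x) (g x) (s.1 x)
  zero_smul s := Subtype.ext <| funext fun x => zero_smul ℂ (s.1 x)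

/-- Restriction of sections. -/
def restrict {U V : Opens X} (h : V ≤ U) : P.sections U →+ P.sections V where
  toFun s := ⟨fun x => s.1 ⟨x.1, h x.2⟩, P.res (U := V) (V := U) (homOfLE h) s.1 s.2⟩
  map_zero' := rfl
  map_add' _ _ := rfl

/-- The presheaf of abelian groups of sections. -/
def abPresheaf : (Opens (TopCat.of X))ᵒᵖ ⥤ Ab.{0} where
  obj U := AddCommGrpCat.of (P.sections U.unop)
  map i := AddCommGrpCat.ofHom (P.restrict i.unop.le)
  map_id _ := rfl
  map_comp _ _ := rfl

instance (U : (Opens (TopCat.of X))ᵒᵖ) :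
    Module ((ringSheaf X).obj.obj U) (P.abPresheaf.obj U) :=
  inferInstanceAs (Module (holFun (X := X) U.unop) (P.sections U.unop))

/-- The sheaf of `𝒪_X`-modules of the families that satisfy the condition. -/
def sheaf : OMod X where
  val := PresheafOfModules.ofPresheaf P.abPresheaf (fun _ _ _ _ _ => rfl)
  isSheaf := by
    rw [CategoryTheory.Presheaf.isSheaf_iff_isSheaf_forget _ _ (CategoryTheory.forget _)]
    exact TopCat.subpresheafToTypes.isSheaf P.toLocalPredicate

end ModulePredicate

section Dual


/-- The sections of a sheaf of modules over `U`. -/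
abbrev sec (M : OMod X) (U : Opens X) : Type := M.val.obj (op (U : Opens (TopCat.of X)))

instance (M : OMod X) (U : Opens X) : Module (holFun U) (sec M U) :=
  (M.val.obj (op (U : Opens (TopCat.of X)))).isModule

/-- Restriction of sections of a sheaf of modules. -/
def secRes (M : OMod X) {U V : Opens X} (h : V ≤ U) : sec M U →+ sec M V where
  toFun m := M.val.map (X := op (U : Opens (TopCat.of X))) (Y := op (V : Opens (TopCat.of X)))
    (homOfLE h).op m
  map_zero' := map_zero _
  map_add' := map_add _

theorem secRes_smul (M : OMod X) {U V : Opens X} (h : V ≤ U) (f : holFun U) (m : sec M U) :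
    secRes M h (f • m) = holRes h f • secRes M h m :=
  M.val.map_smul (homOfLE h).op f m

theorem secRes_secRes (M : OMod X) {U V W : Opens X} (h : V ≤ U) (k : W ≤ V) (m : sec M U) :
    secRes M k (secRes M h m) = secRes M (k.trans h) m :=
  (M.val.map_comp_apply (homOfLE h).op (homOfLE k).op m).symm

theorem secRes_self (M : OMod X) {U : Opens X} (m : sec M U) :
    secRes M le_rfl m = m :=
  CategoryTheory.congr_fun (M.val.map_id (op (U : Opens (TopCat.of X)))) m

/-- Holomorphic functions that agree on overlaps glue. -/
theorem holFun_glue {ι : Type*} (U : ι → Opens X) (V : Opens X) (hU : ∀ i, U i ≤ V)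
    (hV : V ≤ iSup U) (f : ∀ i, holFun (U i))
    (hf : ∀ i j (y : X) (hi : y ∈ U i) (hj : y ∈ U j), f i ⟨y, hi⟩ = f j ⟨y, hj⟩) :
    ∃ g : holFun V, ∀ i, holRes (hU i) g = f i := by
  obtain ⟨g, hg, -⟩ := TopCat.Sheaf.existsUnique_gluing' (F := structureSheaf X) U V
    (fun i => homOfLE (hU i)) hV f (fun i j => ContMDiffMap.ext fun y => hf i j y.1 y.2.1 y.2.2)
  exact ⟨g, hg⟩

theorem holRes_apply {U V : Opens X} (h : V ≤ U) (f : holFun U) (y : V) :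
    holRes h f y = f ⟨y.1, h y.2⟩ := rfl

variable (M : OMod X)

/-- The sections over `U` of `M^* = ℋom(M, 𝒪_X)`: the morphisms of sheaves of modules
`M|_U → 𝒪_X|_U`, that is the families of `𝒪_X(V)`-linear maps `M(V) → 𝒪_X(V)`, `V ⊆ U`,
that commute with restriction. -/
def dualSections (U : Opens X) :
    AddSubgroup (∀ V : {V : Opens X // V ≤ U}, sec M V.1 →ₗ[holFun V.1] holFun V.1) where
  carrier := {l | ∀ (V W : {V : Opens X // V ≤ U}) (h : W.1 ≤ V.1) (m : sec M V.1),
    l W (secRes M h m) = holRes h (l V m)}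
  zero_mem' _ _ _ _ := rfl
  add_mem' {l k} hl hk V W h m := by
    simp only [Pi.add_apply, LinearMap.add_apply, hl V W h m, hk V W h m, map_add]
  neg_mem' {l} hl V W h m := by
    simp only [Pi.neg_apply, LinearMap.neg_apply, hl V W h m, map_neg]

instance (U : Opens X) : Module (holFun U) (dualSections M U) where
  smul f l := ⟨fun V => holRes V.2 f • l.1 V, fun V W h m => by
    simp only [LinearMap.smul_apply, smul_eq_mul, l.2 V W h m, map_mul]
    rfl⟩
  one_smul l := Subtype.ext <| funext fun V => by
    change holRes V.2 1 • l.1 V = l.1 V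
    rw [map_one, one_smul]
  mul_smul f g l := Subtype.ext <| funext fun V => by
    change holRes V.2 (f * g) • l.1 V = holRes V.2 f • holRes V.2 g • l.1 V
    rw [map_mul, mul_smul]
  smul_zero f := Subtype.ext <| funext fun V => smul_zero (holRes V.2 f)
  smul_add f l k := Subtype.ext <| funext fun V => smul_add (holRes V.2 f) (l.1 V) (k.1 V)
  add_smul f g l := Subtype.ext <| funext fun V => by
    change holRes V.2 (f + g) • l.1 V = holRes V.2 f • l.1 V + holRes V.2 g • l.1 V
    rw [map_add, add_smul]
  zero_smul l := Subtype.ext <| funext fun V => by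
    change holRes V.2 0 • l.1 V = 0
    rw [map_zero, zero_smul]

/-- The presheaf of abelian groups underlying `M^*`. -/
def dualAbPresheaf : (Opens (TopCat.of X))ᵒᵖ ⥤ Ab.{0} where
  obj U := AddCommGrpCat.of (dualSections M U.unop)
  map {_ V} i := AddCommGrpCat.ofHom
    { toFun := fun l => (⟨fun W => l.1 ⟨W.1, W.2.trans i.unop.le⟩,
        fun W W' h m => l.2 ⟨W.1, _⟩ ⟨W'.1, _⟩ h m⟩ : dualSections M V.unop)
      map_zero' := rfl
      map_add' := fun _ _ => rfl }
  map_id _ := rfl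
  map_comp _ _ := rfl

instance (U : (Opens (TopCat.of X))ᵒᵖ) :
    Module ((ringSheaf X).obj.obj U) ((dualAbPresheaf M).obj U) :=
  inferInstanceAs (Module (holFun (X := X) U.unop) (dualSections M U.unop))

theorem dual_glue {ι : Type*} (U : ι → Opens X) (l : ∀ i, dualSections M (U i))
    (hl : ∀ i j (W : Opens X) (hi : W ≤ U i) (hj : W ≤ U j), (l i).1 ⟨W, hi⟩ = (l j).1 ⟨W, hj⟩) :
    ∃! k : dualSections M (iSup U), ∀ i (W : Opens X) (hi : W ≤ U i),
      k.1 ⟨W, hi.trans (le_iSup U i)⟩ = (l i).1 ⟨W, hi⟩ := by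
  have cov : ∀ V : Opens X, V ≤ iSup U → V ≤ ⨆ i, V ⊓ U i := fun V hV => by
    rw [← inf_iSup_eq]; exact le_inf le_rfl hV
  have key : ∀ (V : {V : Opens X // V ≤ iSup U}) (m : sec M V.1), ∃ g : holFun V.1,
      ∀ i, holRes (inf_le_left : V.1 ⊓ U i ≤ V.1) g =
        (l i).1 ⟨V.1 ⊓ U i, inf_le_right⟩ (secRes M inf_le_left m) := by
    intro V m
    refine holFun_glue (fun i => V.1 ⊓ U i) V.1 (fun i => inf_le_left) (cov V.1 V.2) _ ?_
    intro i j y hi hj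
    have h1 := (l i).2 ⟨V.1 ⊓ U i, inf_le_right⟩ ⟨V.1 ⊓ (U i ⊓ U j), inf_le_right.trans inf_le_left⟩
      (le_inf inf_le_left (inf_le_right.trans inf_le_left)) (secRes M inf_le_left m)
    have h2 := (l j).2 ⟨V.1 ⊓ U j, inf_le_right⟩ ⟨V.1 ⊓ (U i ⊓ U j), inf_le_right.trans inf_le_right⟩
      (le_inf inf_le_left (inf_le_right.trans inf_le_right)) (secRes M inf_le_left m)
    rw [secRes_secRes] at h1 h2
    have h3 := hl i j (V.1 ⊓ (U i ⊓ U j)) (inf_le_right.trans inf_le_left)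
      (inf_le_right.trans inf_le_right)
    rw [h3] at h1
    have h4 := h1.symm.trans h2
    exact DFunLike.congr_fun h4 ⟨y, hi.1, hi.2, hj.2⟩
  choose g hg using key
  have val : ∀ (V : {V : Opens X // V ≤ iSup U}) (m : sec M V.1) (y : V.1) (i : ι)
      (hy : y.1 ∈ U i), g V m y = (l i).1 ⟨V.1 ⊓ U i, inf_le_right⟩ (secRes M inf_le_left m)
        ⟨y.1, y.2, hy⟩ := fun V m y i hy =>
    DFunLike.congr_fun (hg V m i) ⟨y.1, y.2, hy⟩
  have mem : ∀ (V : {V : Opens X // V ≤ iSup U}) (y : V.1), ∃ i, y.1 ∈ U i := fun V y =>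
    Opens.mem_iSup.mp (V.2 y.2)
  let k : dualSections M (iSup U) :=
    ⟨fun V =>
      { toFun := g V
        map_add' := fun m m' => ContMDiffMap.ext fun y => by
          obtain ⟨i, hi⟩ := mem V y
          rw [val V _ y i hi, map_add, map_add, ContMDiffMap.coe_add, Pi.add_apply,
            ContMDiffMap.coe_add, Pi.add_apply, val V m y i hi, val V m' y i hi]
        map_smul' := fun f m => ContMDiffMap.ext fun y => by
          obtain ⟨i, hi⟩ := mem V y
          rw [val V _ y i hi, secRes_smul, map_smul]
          change _ * _ = f y * g V m y
          rw [val V m y i hi]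
          rfl },
      fun V W h m => ContMDiffMap.ext fun y => by
        obtain ⟨i, hi⟩ := mem W y
        change g W _ y = g V m ⟨y.1, h y.2⟩
        rw [val W _ y i hi, val V m ⟨y.1, h y.2⟩ i hi, secRes_secRes]
        have := (l i).2 ⟨V.1 ⊓ U i, inf_le_right⟩ ⟨W.1 ⊓ U i, inf_le_right⟩
          (inf_le_inf_right _ h) (secRes M inf_le_left m)
        rw [secRes_secRes] at this
        exact DFunLike.congr_fun this ⟨y.1, y.2, hi⟩⟩
  refine ⟨k, ?_, ?_⟩
  · intro i W hi
    refine LinearMap.ext fun m => ContMDiffMap.ext fun y => ?_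
    change g ⟨W, _⟩ m y = _
    rw [val ⟨W, _⟩ m y i (hi y.2)]
    have := (l i).2 ⟨W, hi⟩ ⟨W ⊓ U i, inf_le_right⟩ inf_le_left m
    exact DFunLike.congr_fun this ⟨y.1, y.2, hi y.2⟩
  · intro k' hk'
    refine Subtype.ext <| funext fun V => LinearMap.ext fun m => ContMDiffMap.ext fun y => ?_
    obtain ⟨i, hi⟩ := mem V y
    change _ = g V m y
    rw [val V m y i hi]
    have := k'.2 V ⟨V.1 ⊓ U i, inf_le_left.trans V.2⟩ inf_le_left m
    have h2 := DFunLike.congr_fun this ⟨y.1, y.2, hi⟩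
    rw [hk' i (V.1 ⊓ U i) inf_le_right] at h2
    exact h2.symm

/-- The dual sheaf `M^* = ℋom(M, 𝒪_X)`. -/
def dual : OMod X where
  val := PresheafOfModules.ofPresheaf (dualAbPresheaf M) (fun _ _ _ _ _ => rfl)
  isSheaf := by
    rw [CategoryTheory.Presheaf.isSheaf_iff_isSheaf_forget _ _ (CategoryTheory.forget _)]
    refine TopCat.Presheaf.isSheaf_of_isSheafUniqueGluing_types _ ?_
    intro ι U l hl
    obtain ⟨k, hk, huniq⟩ := dual_glue M U l (fun i j W hi hj =>
      congrFun (congrArg Subtype.val (hl i j)) ⟨W, le_inf hi hj⟩)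
    refine ⟨k, fun i => Subtype.ext <| funext fun W => hk i W.1 W.2, fun k' hk' => ?_⟩
    exact huniq k' fun i W hi => congrFun (congrArg Subtype.val (hk' i)) ⟨W, hi⟩

end Dual

section Tensor
/-- The tensor product `M ⊗ N` over `𝒪_X`: the sheaf associated with
`U ↦ M(U) ⊗ N(U)`, tensor product over `𝒪_X(U)`. -/
def tensor (M N : OMod X) : OMod X :=
  (PresheafOfModules.sheafification (𝟙 (ringSheaf X).obj)).obj
    (PresheafOfModules.Monoidal.tensorObj (R := (structureSheaf X).obj) M.val N.val)

/-- The section `s ⊗ t`. -/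
def tmul {M N : OMod X} {U : Opens X} (s : sec M U) (t : sec N U) : sec (tensor M N) U :=
  ((PresheafOfModules.sheafificationAdjunction (𝟙 (ringSheaf X).obj)).unit.app
    (PresheafOfModules.Monoidal.tensorObj (R := (structureSheaf X).obj) M.val N.val)).app
      (op (U : Opens (TopCat.of X))) (s ⊗ₜ[holFun U] t)

end Tensor

/-- The value at `x` of a section of the sheaf defined by a local condition. -/
def value {T : X → Type} [∀ x, AddCommGroup (T x)] [∀ x, Module ℂ (T x)]
    {P : ModulePredicate T} {U : Opens X} (s : sec P.sheaf U) (x : U) : T x :=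
  (show P.sections U from s).1 x

/-- The linear map `M(V) → 𝒪_X(V)` given by a section over `U ⊇ V` of `M^*`. -/
def dualEval {M : OMod X} {U V : Opens X} (l : sec (dual M) U) (h : V ≤ U) :
    sec M V →ₗ[holFun V] holFun V :=
  (show dualSections M U from l).1 ⟨V, h⟩

/-- The action of a morphism of sheaves of modules on sections. -/
def onSec {M N : OMod X} (S : M ⟶ N) {U : Opens X} (s : sec M U) : sec N U :=
  S.val.app (op (U : Opens (TopCat.of X))) s

end Sheaves

section Divisor

variable {X : Type} [TopologicalSpace X] [ChartedSpace ℂ X]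

/-- A local equation near `x` of the reduced divisor `D`: the coordinate centred at `x`
if `x ∈ D`, and `1` if `x ∉ D`. -/
def localEq (D : Finset X) (x y : X) : ℂ :=
  open Classical in if x ∈ D then chartAt ℂ x y - chartAt ℂ x x else 1

/-- The sections of `𝒪_X(D)`: functions `f` off `D` such that near every point `x`
one has `f = h / ℓ` with `h` holomorphic and `ℓ` the local equation of `D` at `x`,
that is, `f` is holomorphic off `D` with at most simple poles on `D`. -/
def poleData (D : Finset X) : ModulePredicate (X := X) (fun x => PLift (x ∉ D) → ℂ) where
  pred {U} f := ∀ x : U, ∃ h : X → ℂ, ContMDiffAt 𝓘(ℂ, ℂ) 𝓘(ℂ, ℂ) ∞ h x.1 ∧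
    ∀ᶠ y in nhds x.1, ∀ (hy : y ∈ U) (hD : y ∉ D), f ⟨y, hy⟩ ⟨hD⟩ * localEq D x.1 y = h y
  res {U V} i f hf x := by
    obtain ⟨h, h1, h2⟩ := hf ⟨x.1, i.le x.2⟩
    exact ⟨h, h1, h2.mono fun y hy hyU hD => hy (i.le hyU) hD⟩
  locality {U} f hf x := by
    obtain ⟨V, hxV, i, hV⟩ := hf x
    obtain ⟨h, h1, h2⟩ := hV ⟨x.1, hxV⟩
    refine ⟨h, h1, ?_⟩
    filter_upwards [h2, V.isOpen.mem_nhds hxV] with y hy hyV hyU hD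
    exact hy hyV hD
  zero_mem U x := ⟨fun _ => 0, contMDiffAt_const, by simp⟩
  add_mem {U s t} hs ht x := by
    obtain ⟨h, h1, h2⟩ := hs x
    obtain ⟨k, k1, k2⟩ := ht x
    refine ⟨fun y => h y + k y, h1.add k1, ?_⟩
    filter_upwards [h2, k2] with y hy ky hyU hD
    rw [← hy hyU hD, ← ky hyU hD, ← add_mul]
    rfl
  smul_mem {U} f {s} hs x := by
    obtain ⟨h, h1, h2⟩ := hs x
    classical
    let F : X → ℂ := fun y => if hy : y ∈ U then f ⟨y, hy⟩ else 0
    have hF : ContMDiffAt 𝓘(ℂ, ℂ) 𝓘(ℂ, ℂ) ∞ F x.1 := by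
      rw [← contMDiffAt_subtype_iff (U := U) (x := x)]
      have : (fun y : U => F y.1) = f := by
        funext y
        simp [F]
      rw [this]
      exact f.contMDiff x
    refine ⟨fun y => F y * h y, hF.mul h1, ?_⟩
    filter_upwards [h2] with y hy hyU hD
    rw [← hy hyU hD]
    have : F y = f ⟨y, hyU⟩ := by simp [F, hyU]
    rw [this, ← mul_assoc]
    rfl

/-- The invertible sheaf `𝒪_X(D)` of a reduced effective divisor `D`. -/
def OD (D : Finset X) : OMod X := (poleData D).sheaf

end Divisor

section Groups

open Matrix MvPolynomial

variable {n : ℕ}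

/-- The value of a polynomial in the entries of an `n × n` matrix. -/
def evalMat (A : Matrix (Fin n) (Fin n) ℂ) (f : MvPolynomial (Fin n × Fin n) ℂ) : ℂ :=
  MvPolynomial.eval (fun p => A p.1 p.2) f

/-- A set of invertible matrices is Zariski closed if it is cut out in `GL_n` by polynomial
equations in the matrix entries. -/
def IsZariskiClosed (S : Set (GL (Fin n) ℂ)) : Prop :=
  ∃ P : Set (MvPolynomial (Fin n × Fin n) ℂ), S = {g | ∀ f ∈ P, evalMat g.1 f = 0}

/-- The derivative at the identity matrix of a polynomial in the matrix entries, in the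
direction `A`. -/
def derivOne (f : MvPolynomial (Fin n × Fin n) ℂ) (A : Matrix (Fin n) (Fin n) ℂ) : ℂ :=
  ∑ p : Fin n × Fin n, evalMat 1 (pderiv p f) * A p.1 p.2

/-- The Lie algebra of an algebraic subgroup `G` of `GL_n`, as a subspace of the space of
matrices: the tangent space at the identity, cut out by the differentials of all polynomials
that vanish on `G`. -/
def lieAlg (G : Subgroup (GL (Fin n) ℂ)) : Submodule ℂ (Matrix (Fin n) (Fin n) ℂ) where
  carrier := {A | ∀ f, (∀ g ∈ G, evalMat g.1 f = 0) → derivOne f A = 0}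
  zero_mem' f _ := by simp [derivOne]
  add_mem' {A B} hA hB f hf := by
    have h : derivOne f (A + B) = derivOne f A + derivOne f B := by
      simp [derivOne, mul_add, Finset.sum_add_distrib]
    rw [h, hA f hf, hB f hf, add_zero]
  smul_mem' c A hA f hf := by
    have h : derivOne f (c • A) = c * derivOne f A := by
      simp only [derivOne, Finset.mul_sum, Matrix.smul_apply, smul_eq_mul]
      exact Finset.sum_congr rfl fun _ _ => by ring
    rw [h, hA f hf, mul_zero]

/-- The polynomials giving the entries of `g * x * h`. -/
def conjPoly (g h : Matrix (Fin n) (Fin n) ℂ) (p : Fin n × Fin n) :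
    MvPolynomial (Fin n × Fin n) ℂ :=
  ∑ q : Fin n × Fin n, C (g p.1 q.1 * h q.2 p.2) * X q

theorem conj_entry (g A h : Matrix (Fin n) (Fin n) ℂ) (i j : Fin n) :
    (g * A * h) i j = ∑ q : Fin n × Fin n, g i q.1 * h q.2 j * A q.1 q.2 := by
  simp only [Matrix.mul_apply, Finset.sum_mul, Fintype.sum_prod_type]
  rw [Finset.sum_comm]
  exact Finset.sum_congr rfl fun _ _ => Finset.sum_congr rfl fun _ _ => by ring

theorem evalMat_bind (g h A : Matrix (Fin n) (Fin n) ℂ) (f : MvPolynomial (Fin n × Fin n) ℂ) :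
    evalMat A (bind₁ (conjPoly g h) f) = evalMat (g * A * h) f := by
  unfold evalMat
  rw [MvPolynomial.eval, eval₂Hom_bind₁]
  congr 2
  funext p
  rw [conj_entry]
  simp [conjPoly]

theorem derivOne_mul (f k : MvPolynomial (Fin n × Fin n) ℂ) (A : Matrix (Fin n) (Fin n) ℂ) :
    derivOne (f * k) A = derivOne f A * evalMat 1 k + evalMat 1 f * derivOne k A := by
  simp only [derivOne, evalMat, Derivation.leibniz, smul_eq_mul, map_add, map_mul,
    Finset.sum_mul, Finset.mul_sum, ← Finset.sum_add_distrib]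
  exact Finset.sum_congr rfl fun _ _ => by ring

theorem derivOne_X (p : Fin n × Fin n) (A : Matrix (Fin n) (Fin n) ℂ) :
    derivOne (X p) A = A p.1 p.2 := by
  classical
  simp [derivOne, evalMat, pderiv_X, Pi.single_apply]

theorem derivOne_bind (g h A : Matrix (Fin n) (Fin n) ℂ) (hgh : g * h = 1)
    (f : MvPolynomial (Fin n × Fin n) ℂ) :
    derivOne (bind₁ (conjPoly g h) f) A = derivOne f (g * A * h) := by
  induction f using MvPolynomial.induction_on with
  | C a => simp [derivOne, evalMat]
  | add f k hf hk =>
    have h : ∀ (u v : MvPolynomial (Fin n × Fin n) ℂ) (B : Matrix (Fin n) (Fin n) ℂ),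
        derivOne (u + v) B = derivOne u B + derivOne v B := fun u v B => by
      simp [derivOne, evalMat, add_mul, Finset.sum_add_distrib]
    rw [map_add, h, h, hf, hk]
  | mul_X f p hf =>
    have hX : derivOne (conjPoly g h p) A = (g * A * h) p.1 p.2 := by
      rw [conj_entry]
      classical
      simp only [derivOne, conjPoly, evalMat, map_sum, Derivation.leibniz, pderiv_C, pderiv_X,
        smul_eq_mul, map_mul, Pi.single_apply]
      simp [apply_ite]
    rw [map_mul, derivOne_mul, derivOne_mul, hf, evalMat_bind, evalMat_bind, mul_one, hgh,
      derivOne_X, bind₁_X_right, hX]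

theorem conj_mem_lieAlg (G : Subgroup (GL (Fin n) ℂ)) {g : GL (Fin n) ℂ} (hg : g ∈ G)
    {A : Matrix (Fin n) (Fin n) ℂ} (hA : A ∈ lieAlg G) :
    g.1 * A * (g⁻¹).1 ∈ lieAlg G := by
  intro f hf
  rw [← derivOne_bind _ _ _ g.mul_inv]
  refine hA _ fun k hk => ?_
  rw [evalMat_bind]
  exact hf (g * k * g⁻¹) (G.mul_mem (G.mul_mem hg hk) (G.inv_mem hg))

/-- The adjoint action of `G` on its Lie algebra. -/
def Ad (G : Subgroup (GL (Fin n) ℂ)) (g : G) : lieAlg G →ₗ[ℂ] lieAlg G where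
  toFun A := ⟨g.1.1 * A.1 * (g.1⁻¹).1, conj_mem_lieAlg G g.2 A.2⟩
  map_add' A B := Subtype.ext <| by simp [mul_add, add_mul]
  map_smul' c A := Subtype.ext <| by simp

/-- The Lie algebra of a subgroup `H` of `G`, as a subspace of the Lie algebra of `G`. -/
def lieSub {G : Subgroup (GL (Fin n) ℂ)} (H : Subgroup G) : Submodule ℂ (lieAlg G) :=
  (lieAlg (H.map G.subtype)).comap (lieAlg G).subtype

/-- A subgroup of `G` is Zariski closed. -/
def IsZariskiClosedSubgroup {G : Subgroup (GL (Fin n) ℂ)} (H : Subgroup G) : Prop :=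
  IsZariskiClosed ((H.map G.subtype : Subgroup (GL (Fin n) ℂ)) : Set (GL (Fin n) ℂ))

/-- `G` is reductive: its unipotent radical is trivial, i.e. the only Zariski closed connected
normal subgroup of `G` that consists of unipotent matrices is the trivial one. -/
def IsReductive (G : Subgroup (GL (Fin n) ℂ)) : Prop :=
  ∀ N : Subgroup G, N.Normal → IsZariskiClosedSubgroup N → IsConnected (N : Set G) →
    (∀ g ∈ N, IsNilpotent ((g : GL (Fin n) ℂ).1 - 1)) → N = ⊥

/-- The complex manifold structure on `G` is the one of a complex submanifold of the space of
matrices: the inclusion is a holomorphic immersion (`G` carries the subspace topology). -/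
def IsComplexSubmanifold (V : Type*) [NormedAddCommGroup V] [NormedSpace ℂ V]
    (G : Subgroup (GL (Fin n) ℂ)) [ChartedSpace V G] : Prop :=
  ContMDiff 𝓘(ℂ, V) 𝓘(ℂ, Fin n → Fin n → ℂ) ∞ (fun (g : G) i j => g.1.1 i j) ∧
  ∀ g : G, Function.Injective
    (mfderiv 𝓘(ℂ, V) 𝓘(ℂ, Fin n → Fin n → ℂ) (fun (g : G) i j => g.1.1 i j) g)

/-- A nondegenerate symmetric `G`-invariant bilinear form on the Lie algebra of `G`. -/
structure InvariantForm (G : Subgroup (GL (Fin n) ℂ)) where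
  form : LinearMap.BilinForm ℂ (lieAlg G)
  symm : ∀ a b, form a b = form b a
  nondegenerate : form.Nondegenerate
  invariant : ∀ (g : G) (a b), form (Ad G g a) (Ad G g b) = form a b

end Groups

section Bundles

variable {n : ℕ}

/-- A holomorphic principal `G`-bundle `E → X`: a holomorphic map with a holomorphic right action
of `G` on `E`, which is locally on `X` isomorphic to the product with `G`. -/
structure PrincipalBundle (F V : Type*) [NormedAddCommGroup F] [NormedSpace ℂ F]
    [NormedAddCommGroup V] [NormedSpace ℂ V]
    (G : Subgroup (GL (Fin n) ℂ)) [ChartedSpace V G]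
    (X : Type) [TopologicalSpace X] [ChartedSpace ℂ X]
    (E : Type) [TopologicalSpace E] [ChartedSpace F E] where
  /-- the projection -/
  proj : E → X
  /-- the right action -/
  act : E → G → E
  act_one : ∀ z, act z 1 = z
  act_mul : ∀ z g h, act z (g * h) = act (act z g) h
  proj_act : ∀ z g, proj (act z g) = proj z
  proj_hol : ContMDiff 𝓘(ℂ, F) 𝓘(ℂ, ℂ) ∞ proj
  act_hol : ContMDiff (𝓘(ℂ, F).prod 𝓘(ℂ, V)) 𝓘(ℂ, F) ∞ (fun q : E × G => act q.1 q.2)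
  locally_trivial : ∀ x : X, ∃ e : Bundle.Trivialization G proj, x ∈ e.baseSet ∧
    ContMDiffOn 𝓘(ℂ, F) (𝓘(ℂ, ℂ).prod 𝓘(ℂ, V)) ∞ e e.source ∧
    ContMDiffOn (𝓘(ℂ, ℂ).prod 𝓘(ℂ, V)) 𝓘(ℂ, F) ∞ e.toOpenPartialHomeomorph.symm e.target ∧
    ∀ z ∈ e.source, ∀ g : G, e (act z g) = ((e z).1, (e z).2 * g)

namespace PrincipalBundle

variable {F V : Type*} [NormedAddCommGroup F] [NormedSpace ℂ F]
  [NormedAddCommGroup V] [NormedSpace ℂ V]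
  {G : Subgroup (GL (Fin n) ℂ)} [ChartedSpace V G]
  {X : Type} [TopologicalSpace X] [ChartedSpace ℂ X]
  {E : Type} [TopologicalSpace E] [ChartedSpace F E]
  (B : PrincipalBundle F V G X E)

/-- The fiber of `E` over `x`. -/
abbrev Fiber (x : X) : Type := {z : E // B.proj z = x}

variable {B} in
/-- The action of `G` on a fiber. -/
def Fiber.act {x : X} (z : B.Fiber x) (g : G) : B.Fiber x :=
  ⟨B.act z.1 g, (B.proj_act z.1 g).trans z.2⟩

theorem nonempty_fiber (x : X) : Nonempty (B.Fiber x) := by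
  obtain ⟨e, hx, -⟩ := B.locally_trivial x
  exact ⟨⟨e.toOpenPartialHomeomorph.symm (x, 1), e.proj_symm_apply' hx⟩⟩

theorem exists_act_eq {x : X} (z w : B.Fiber x) : ∃ g : G, w = z.act g := by
  obtain ⟨e, hx, -, -, he⟩ := B.locally_trivial x
  have hz : z.1 ∈ e.source := e.mem_source.mpr (z.2.symm ▸ hx)
  have hw : w.1 ∈ e.source := e.mem_source.mpr (w.2.symm ▸ hx)
  refine ⟨(e z.1).2⁻¹ * (e w.1).2, Subtype.ext ?_⟩
  have hzg : B.act z.1 ((e z.1).2⁻¹ * (e w.1).2) ∈ e.source :=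
    e.mem_source.mpr (((B.proj_act _ _).trans z.2).symm ▸ hx)
  refine e.injOn hw hzg ?_
  change e w.1 = e (B.act z.1 _)
  rw [he z.1 hz, mul_inv_cancel_left]
  refine Prod.ext ?_ rfl
  change (e w.1).1 = (e z.1).1
  rw [e.coe_fst hw, e.coe_fst hz, w.2, z.2]

/-- The relation `w = z h` with `h ∈ H`, on the fiber over `x`. -/
def orbitSetoid (x : X) (H : Subgroup G) : Setoid (B.Fiber x) where
  r z w := ∃ h ∈ H, w = z.act h
  iseqv :=
    { refl := fun z => ⟨1, H.one_mem, Subtype.ext (B.act_one z.1).symm⟩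
      symm := by
        rintro z w ⟨h, hh, rfl⟩
        refine ⟨h⁻¹, H.inv_mem hh, Subtype.ext ?_⟩
        change z.1 = B.act (B.act z.1 h) h⁻¹
        rw [← B.act_mul, mul_inv_cancel, B.act_one]
      trans := by
        rintro z w v ⟨h, hh, rfl⟩ ⟨k, hk, rfl⟩
        exact ⟨h * k, H.mul_mem hh hk, Subtype.ext (B.act_mul z.1 h k).symm⟩ }

/-- A framing over `D`: a point of `E_x / H_x` for each `x ∈ D`. -/
def Framing (D : Finset X) (H : {x // x ∈ D} → Subgroup G) : Type :=
  ∀ x : {x // x ∈ D}, Quotient (B.orbitSetoid x.1 (H x))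

/-- The fiber `ad(E)_x` of the adjoint bundle: the `G`-invariant vertical vector fields
along the fiber `E_x`, that is, in terms of the trivialization of the vertical tangent bundle by
the action, the maps `v : E_x → 𝔤` with `v (z g) = Ad(g⁻¹) (v z)`. -/
def adFiber (x : X) : Submodule ℂ (B.Fiber x → lieAlg G) where
  carrier := {v | ∀ z g, v (z.act g) = Ad G g⁻¹ (v z)}
  zero_mem' z g := by simp
  add_mem' {v w} hv hw z g := by simp [hv z g, hw z g]
  smul_mem' c v hv z g := by simp [hv z g]

/-- The open set of the points of `E` over `U`. -/
def preimage (U : Opens X) : Opens E := ⟨B.proj ⁻¹' U, U.isOpen.preimage B.proj_hol.continuous⟩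

/-- The map `p⁻¹(U) → 𝔤` given by a family of elements of the fibers of `ad(E)` over `U`. -/
def total {U : Opens X} (s : ∀ x : U, B.adFiber x.1) (z : B.preimage U) : Fin n → Fin n → ℂ :=
  fun i j => ((s ⟨B.proj z.1, z.2⟩).1 ⟨z.1, rfl⟩).1 i j

/-- Given subspaces `W_x ⊆ ad(E)_x` for `x ∈ D`, the holomorphic sections `s` of `ad(E)`
with `s(x) ∈ W_x` for all `x ∈ D` in the domain of `s`. -/
def adData (D : Finset X) (W : ∀ x : {x // x ∈ D}, Submodule ℂ (B.adFiber x.1)) :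
    ModulePredicate (X := X) (fun x => B.adFiber x) where
  pred {U} s := ContMDiff 𝓘(ℂ, F) 𝓘(ℂ, Fin n → Fin n → ℂ) ∞ (B.total (U := U) s) ∧
    ∀ (x : {x // x ∈ D}) (hx : x.1 ∈ U), s ⟨x.1, hx⟩ ∈ W x
  res {U V} i s hs := by
    refine ⟨?_, fun x hx => hs.2 x (i.le hx)⟩
    have h : (B.preimage U : Set E) ⊆ B.preimage V := fun z hz => i.le hz
    exact hs.1.comp (contMDiff_inclusion h)
  locality {U} s hs := by
    refine ⟨?_, fun x hx => ?_⟩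
    · refine ((contDiffWithinAt_localInvariantProp (I := 𝓘(ℂ, F))
        (I' := 𝓘(ℂ, Fin n → Fin n → ℂ)) ∞).localPredicate E (Fin n → Fin n → ℂ)).locality
          (U := B.preimage U) (B.total (U := U) s) fun z => ?_
      obtain ⟨V, hV, i, h, -⟩ := hs ⟨B.proj z.1, z.2⟩
      exact ⟨B.preimage V, hV, homOfLE fun w hw => i.le hw, h⟩
    · obtain ⟨V, hV, i, h⟩ := hs ⟨x.1, hx⟩
      exact h.2 x hV
  zero_mem U := ⟨contMDiff_const (c := (0 : Fin n → Fin n → ℂ)), fun x _ => (W x).zero_mem⟩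
  add_mem {U s t} hs ht := ⟨hs.1.add ht.1, fun x hx => (W x).add_mem (hs.2 x hx) (ht.2 x hx)⟩
  smul_mem {U} f {s} hs := by
    refine ⟨?_, fun x hx => (W x).smul_mem _ (hs.2 x hx)⟩
    have hp : ContMDiff 𝓘(ℂ, F) 𝓘(ℂ, ℂ) ∞
        (fun z : B.preimage U => (⟨B.proj z.1, z.2⟩ : U)) := by
      rw [← ContMDiff.subtypeVal_comp_iff]
      exact B.proj_hol.comp contMDiff_subtype_val
    exact (f.contMDiff.comp hp).smul hs.1

variable {B} in
/-- The bilinear form on `ad(E)_x` induced by an invariant form on the Lie algebra. -/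
def hat (σ : InvariantForm G) (x : X) : LinearMap.BilinForm ℂ (B.adFiber x) :=
  σ.form.compl₁₂
    (LinearMap.proj (Classical.choice (B.nonempty_fiber x)) ∘ₗ (B.adFiber x).subtype)
    (LinearMap.proj (Classical.choice (B.nonempty_fiber x)) ∘ₗ (B.adFiber x).subtype)

/-- The induced form can be computed at any point of the fiber of `E`. -/
theorem hat_apply (σ : InvariantForm G) {x : X} (v w : B.adFiber x) (z : B.Fiber x) :
    hat σ x v w = σ.form (v.1 z) (w.1 z) := by
  obtain ⟨g, hg⟩ := B.exists_act_eq z (Classical.choice (B.nonempty_fiber x))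
  change σ.form (v.1 (Classical.choice (B.nonempty_fiber x)))
    (w.1 (Classical.choice (B.nonempty_fiber x))) = _
  rw [hg, v.2, w.2, σ.invariant]

section Framed

variable {D : Finset X} {H : {x // x ∈ D} → Subgroup G} (φ : B.Framing D H)

/-- The subspace `ℋ_x ⊆ ad(E)_x` of the invariant vertical vector fields whose values at the
points of the orbit `φ(x) ⊆ E_x` lie in the Lie algebra of `H_x`. -/
def framingSubspace (x : {x // x ∈ D}) : Submodule ℂ (B.adFiber x.1) where
  carrier := {v | ∀ z : B.Fiber x.1, Quotient.mk (B.orbitSetoid x.1 (H x)) z = φ x →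
    v.1 z ∈ lieSub (H x)}
  zero_mem' _ _ := (lieSub (H x)).zero_mem
  add_mem' hv hw z hz := (lieSub (H x)).add_mem (hv z hz) (hw z hz)
  smul_mem' c _ hv z hz := (lieSub (H x)).smul_mem c (hv z hz)

/-- The annihilator `ℋ_x^⊥` of `ℋ_x` for the form induced by `σ`. -/
def framingPerp (σ : InvariantForm G) (x : {x // x ∈ D}) : Submodule ℂ (B.adFiber x.1) :=
  (hat σ x.1).orthogonal (B.framingSubspace φ x)

/-- The sheaf `ad_φ(E)` of the sections of `ad(E)` with values in `ℋ_x` at every `x ∈ D`. -/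
def adFramed : OMod X := (B.adData D (B.framingSubspace φ)).sheaf

/-- The sheaf `ad^n_φ(E)` of the sections of `ad(E)` with values in `ℋ_x^⊥` at every `x ∈ D`. -/
def adFramedPerp (σ : InvariantForm G) : OMod X := (B.adData D (B.framingPerp φ σ)).sheaf

end Framed

end PrincipalBundle

end Bundles

end FramedBundle

end

/-! Both statements are one duality. If subspaces `W x` and `W' x` of the fibers over `D` satisfy
`W' x = (W x)^⊥`, then `(s, f) ↦ (t ↦ f σ(s, t))` identifies the `W'`-sections twisted by `𝒪(D)`
with the dual of the `W`-sections (`existsUnique_duality_iso`). The first statement is the case `W =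
ℋ`, `W' = ℋ^⊥`; the second exchanges them, which is allowed because the induced form is
nondegenerate on a finite-dimensional fiber and so `ℋ^⊥⊥ = ℋ`.

The pairing is defined because `σ(s, t)` is holomorphic and vanishes on `D`, which cancels the
simple pole of `f`. Everything else is checked off `D`, where the formula is explicit: a holomorphic
function is determined there by density.

Bijectivity is local. Choose a local equation `ℓ` of `D`, the generator `f₀ = 1/ℓ` of `𝒪(D)`, and
frames `b`, `c` of `ad(E)` with `v = ∑ σ(v, b i) c i`. Sections divisible by `ℓ` lie in every sheaf
of `W`-sections. Pairing `s ⊗ f₀` with `ℓ b i` gives `σ(s, b i)`, and these coefficients determine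
`s` (`pairing_locally_injective`). Given a functional `k`, put `s₀ = ∑ k(ℓ c i) b i`; expanding `ℓ
t` in the sections `ℓ c i` gives `σ(s₀, t) = ℓ k(t)`. This vanishes on `D`, so `s₀` takes values in
`W^⊥ = W'` there, and `k` is the image of `s₀ ⊗ f₀` (`pairing_locally_surjective`).
`existsUnique_tensor_iso` passes from the presheaf tensor product to its sheafification. -/

noncomputable section

namespace FramedBundle

open scoped TensorProduct

/-! ### Isomorphisms out of a sheafified tensor product -/

section TensorIso

variable {X : Type} [TopologicalSpace X] [ChartedSpace ℂ X] {M N K : OMod X}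

/-- A family of bilinear pairings, compatible with restriction, as a morphism from the presheaf
tensor product. -/
def pairingHom (b : ∀ U : Opens X, sec M U →ₗ[holFun U] sec N U →ₗ[holFun U] sec K U)
    (hb : ∀ {U V : Opens X} (h : V ≤ U) (s : sec M U) (t : sec N U),
      secRes K h (b U s t) = b V (secRes M h s) (secRes N h t)) :
    PresheafOfModules.Monoidal.tensorObj (R := (structureSheaf X).obj) M.val N.val ⟶
      (PresheafOfModules.restrictScalars (𝟙 (ringSheaf X).obj)).obj K.val where
  app U := ModuleCat.ofHom (TensorProduct.lift (b U.unop))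
  naturality {U V} i := by
    refine ModuleCat.MonoidalCategory.tensor_ext fun s t => ?_
    exact (hb i.unop.le s t).symm

/-- The presheaf tensor product of two sheaves of modules. -/
abbrev preTensor (M N : OMod X) : PresheafOfModules (ringSheaf X).obj :=
  PresheafOfModules.Monoidal.tensorObj (R := (structureSheaf X).obj) M.val N.val

theorem preTensor_hom_ext {K : OMod X}
    {f g : preTensor M N ⟶ (PresheafOfModules.restrictScalars (𝟙 (ringSheaf X).obj)).obj K.val}
    (h : ∀ (U : Opens X) (s : sec M U) (t : sec N U),
      (f.app (op (U : Opens (TopCat.of X))) (s ⊗ₜ[holFun U] t) : sec K U) =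
        g.app (op (U : Opens (TopCat.of X))) (s ⊗ₜ[holFun U] t)) : f = g := by
  refine PresheafOfModules.hom_ext fun U => ?_
  exact ModuleCat.MonoidalCategory.tensor_ext fun s t => h U.unop s t

theorem homEquiv_app_tmul {K : OMod X} (S : tensor M N ⟶ K) {U : Opens X} (s : sec M U)
    (t : sec N U) :
    (((PresheafOfModules.sheafificationAdjunction (𝟙 (ringSheaf X).obj)).homEquiv
      (preTensor M N) K S).app (op (U : Opens (TopCat.of X))) (s ⊗ₜ[holFun U] t) : sec K U) =
      onSec S (tmul s t) := rfl

theorem tensor_hom_ext {K : OMod X} {S T : tensor M N ⟶ K}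
    (h : ∀ (U : Opens X) (s : sec M U) (t : sec N U), onSec S (tmul s t) = onSec T (tmul s t)) :
    S = T :=
  ((PresheafOfModules.sheafificationAdjunction (𝟙 (ringSheaf X).obj)).homEquiv
    (preTensor M N) K).injective (preTensor_hom_ext h)

-- The adjunct of `S` is the sheafification unit followed by `S`. The unit is locally surjective, so
-- local injectivity of the composite passes to `S`; local surjectivity passes to the last factor in
-- any case. A locally bijective morphism of sheaves is an isomorphism.
open PresheafOfModules in
theorem isIso_of_isLocallyBijective {C : Type} [SmallCategory C] {J : GrothendieckTopology C}
    {R : Sheaf J RingCat.{0}} {P : PresheafOfModules.{0} R.obj} {K : SheafOfModules.{0} R}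
    (S : (sheafification (𝟙 R.obj)).obj P ⟶ K)
    [hinj : Presheaf.IsLocallyInjective J
      ((toPresheaf R.obj).map ((sheafificationAdjunction (𝟙 R.obj)).homEquiv P K S))]
    [hsurj : Presheaf.IsLocallySurjective J
      ((toPresheaf R.obj).map ((sheafificationAdjunction (𝟙 R.obj)).homEquiv P K S))] :
    IsIso S := by
  have fac : (toPresheaf R.obj).map ((sheafificationAdjunction (𝟙 R.obj)).homEquiv P K S) =
      CategoryTheory.toSheafify J P.presheaf ≫ (toPresheaf R.obj).map S.val :=
    toPresheaf_map_sheafificationHomEquiv_def (𝟙 R.obj) S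
  have h1 : Presheaf.IsLocallyInjective J ((toPresheaf R.obj).map S.val) :=
    @Presheaf.isLocallyInjective_of_isLocallyInjective_of_isLocallySurjective_fac
      _ _ J _ _ _ _ _ _ _ _ _ _ _ _ fac.symm hinj
        (GrothendieckTopology.W.isLocallySurjective (J.W_toSheafify _))
  have h2 : Presheaf.IsLocallySurjective J ((toPresheaf R.obj).map S.val) :=
    @Presheaf.isLocallySurjective_of_isLocallySurjective_fac
      _ _ J _ _ _ _ _ _ _ _ _ _ _ _ fac.symm hsurj
  rw [← isIso_iff_of_reflects_iso _ (SheafOfModules.toSheaf R)]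
  exact (Sheaf.isLocallyBijective_iff_isIso (A := AddCommGrpCat.{0})
    ((SheafOfModules.toSheaf R).map S)).mp ⟨h1, h2⟩

/-- A pairing that is locally bijective, the second factor being locally generated by one
section, induces a unique isomorphism from the tensor product. -/
theorem existsUnique_tensor_iso
    (b : ∀ U : Opens X, sec M U →ₗ[holFun U] sec N U →ₗ[holFun U] sec K U)
    (hb : ∀ {U V : Opens X} (h : V ≤ U) (s : sec M U) (t : sec N U),
      secRes K h (b U s t) = b V (secRes M h s) (secRes N h t))
    (hinj : ∀ (U : Opens X), ∀ x ∈ U, ∃ V ≤ U, x ∈ V ∧ ∃ t₀ : sec N V,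
      (∀ t : sec N V, ∃ h : holFun V, t = h • t₀) ∧ ∀ s : sec M V, b V s t₀ = 0 → s = 0)
    (hsurj : ∀ (U : Opens X) (k : sec K U), ∀ x ∈ U, ∃ (V : Opens X) (h : V ≤ U), x ∈ V ∧
      ∃ (s : sec M V) (t : sec N V), b V s t = secRes K h k) :
    ∃! S : tensor M N ≅ K, ∀ (U : Opens X) (s : sec M U) (t : sec N U),
      onSec S.hom (tmul s t) = b U s t := by
  let e := (PresheafOfModules.sheafificationAdjunction (𝟙 (ringSheaf X).obj)).homEquiv
    (preTensor M N) K
  let S : tensor M N ⟶ K := e.symm (pairingHom b hb)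
  have hS : e S = pairingHom b hb := e.apply_symm_apply _
  have : IsIso S := by
    refine @isIso_of_isLocallyBijective _ _ _ _ _ _ S ?_ ?_
    · change Presheaf.IsLocallyInjective _ ((PresheafOfModules.toPresheaf _).map (e S))
      rw [hS]
      refine ⟨fun {U} x y hxy p hp => ?_⟩
      obtain ⟨V, h, hpV, t₀, ht₀, hV⟩ := hinj U.unop p hp
      refine ⟨V, homOfLE h, ?_, hpV⟩
      -- Since `t₀` generates, scalars move across the tensor sign and every tensor is pure with
      -- second factor `t₀`. Injectivity on tensors thus reduces to injectivity of `s ↦ b V s t₀`.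
      have gen : ∀ z : sec M V ⊗[holFun V] sec N V, ∃ s : sec M V, z = s ⊗ₜ[holFun V] t₀ := by
        intro z
        induction z using TensorProduct.induction_on with
        | zero => exact ⟨0, (TensorProduct.zero_tmul _ _).symm⟩
        | tmul s t =>
          obtain ⟨f, rfl⟩ := ht₀ t
          exact ⟨f • s, (TensorProduct.smul_tmul f s t₀).symm⟩
        | add z w hz hw =>
          obtain ⟨s, rfl⟩ := hz
          obtain ⟨r, rfl⟩ := hw
          exact ⟨s + r, (TensorProduct.add_tmul _ _ _).symm⟩
      let res := (preTensor M N).map (homOfLE h : V ⟶ U.unop).op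
      have nat := PresheafOfModules.naturality_apply (pairingHom b hb)
        (homOfLE h : V ⟶ U.unop).op
      have key : TensorProduct.lift (b V) (res x) = TensorProduct.lift (b V) (res y) :=
        (nat x).trans ((congrArg _ hxy).trans (nat y).symm)
      obtain ⟨s, hs⟩ := gen (res x)
      obtain ⟨r, hr⟩ := gen (res y)
      rw [hs, hr, TensorProduct.lift.tmul, TensorProduct.lift.tmul] at key
      have hsr : s = r := sub_eq_zero.mp (hV _ (by rw [map_sub, LinearMap.sub_apply, key, sub_self]))
      change res x = res y
      rw [hs, hr, hsr]
    · change Presheaf.IsLocallySurjective _ ((PresheafOfModules.toPresheaf _).map (e S))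
      rw [hS]
      refine ⟨fun {U} k x hx => ?_⟩
      obtain ⟨V, h, hxV, s, t, hst⟩ := hsurj U k x hx
      exact ⟨V, homOfLE h, ⟨s ⊗ₜ[holFun V] t, hst⟩, hxV⟩
  have hval : ∀ (U : Opens X) (s : sec M U) (t : sec N U), onSec S (tmul s t) = b U s t :=
    fun U s t => by rw [← homEquiv_app_tmul]; change (e S).app _ _ = _; rw [hS]; rfl
  exact ⟨asIso S, hval, fun T hT => Iso.ext (tensor_hom_ext fun U s t =>
    (hT U s t).trans (hval U s t).symm)⟩

end TensorIso

/-! ### Holomorphic functions near a finite set and division by a coordinate -/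

section Holomorphic

variable {X : Type} [TopologicalSpace X] [ChartedSpace ℂ X]

/-- A chart would map an isolated point to an open singleton of `ℂ`. -/
theorem nhdsNE_neBot (x : X) : (nhdsWithin x {x}ᶜ).NeBot := by
  refine ⟨fun h => ?_⟩
  have hx : IsOpen ({x} : Set X) := (isOpen_singleton_iff_punctured_nhds x).mpr h
  have h2 := (chartAt ℂ x).isOpen_image_of_subset_source hx
    (Set.singleton_subset_iff.mpr (mem_chart_source ℂ x))
  rw [Set.image_singleton] at h2
  exact not_isOpen_singleton _ h2

/-- Without isolated points, the complement of a finite set is dense. This is the reason that all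
later identities need checking only off `D`. -/
theorem holFun_ext_of_notMem [T1Space X] {D : Finset X} {V : Opens X} {f g : holFun V}
    (h : ∀ y : V, y.1 ∉ D → f y = g y) : f = g := by
  have : ∀ x : V, (nhdsWithin x {x}ᶜ).NeBot := fun x => nhdsNE_neBot x
  have hd : Dense {y : V | y.1 ∉ D} := by
    have hfin : {y : V | y.1 ∈ D}.Finite := D.finite_toSet.preimage Subtype.val_injective.injOn
    exact (dense_univ.sdiff_finite hfin).mono fun y hy => hy.2
  exact ContMDiffMap.ext fun y => congrFun
    (Continuous.ext_on hd f.contMDiff.continuous g.contMDiff.continuous h) y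

theorem contMDiffAt_of_eventuallyEq_holFun {U : Opens X} (f : holFun U) {F : X → ℂ} {x : X}
    (hx : x ∈ U) (h : ∀ᶠ y in nhds x, ∀ hy : y ∈ U, F y = f ⟨y, hy⟩) :
    ContMDiffAt 𝓘(ℂ, ℂ) 𝓘(ℂ, ℂ) ∞ F x := by
  have : ContMDiffAt 𝓘(ℂ, ℂ) 𝓘(ℂ, ℂ) ∞ (fun y : U => F y.1) ⟨x, hx⟩ := by
    refine (f.contMDiff ⟨x, hx⟩).congr_of_eventuallyEq ?_
    filter_upwards [(continuous_subtype_val.tendsto (⟨x, hx⟩ : U)).eventually h] with y hy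
    exact hy y.2
  exact contMDiffAt_subtype_iff.mp this

/-- The local extensions `k x` need no separate gluing: the value at `y` is taken from the extension
chosen at `y` itself. Near `x` this agrees with `k x`, because off `D` both equal `F`, and the only
possible point of `D` close to `x` is `x`. -/
theorem exists_holFun_of_local [T1Space X] (D : Finset X) (V : Opens X)
    (F : ∀ y : V, y.1 ∉ D → ℂ)
    (h : ∀ x : V, ∃ k : X → ℂ, ContMDiffAt 𝓘(ℂ, ℂ) 𝓘(ℂ, ℂ) ∞ k x.1 ∧
      ∀ᶠ y in nhds x.1, ∀ (hy : y ∈ V) (hD : y ∉ D), F ⟨y, hy⟩ hD = k y) :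
    ∃ g : holFun V, ∀ (y : V) (hy : y.1 ∉ D), g y = F y hy := by
  choose k hk hF using h
  refine ⟨⟨fun y => k y y.1, fun x => ?_⟩, fun y hy => ((hF y).self_of_nhds y.2 hy).symm⟩
  have key : ContMDiffAt 𝓘(ℂ, ℂ) 𝓘(ℂ, ℂ) ∞ (fun y : V => k x y.1) x :=
    contMDiffAt_subtype_iff.mpr (hk x)
  refine key.congr_of_eventuallyEq ?_
  have hfin : ∀ᶠ y in nhds x.1, y ∉ (D : Set X) \ {x.1} :=
    (D.finite_toSet.subset Set.sdiff_subset).isClosed.isOpen_compl.mem_nhds (by simp)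
  filter_upwards [(continuous_subtype_val.tendsto x).eventually ((hF x).and hfin)] with y hy
  by_cases hD : y.1 ∈ D
  · have : y = x := by
      by_contra hne
      exact hy.2 ⟨hD, fun h => hne (Subtype.ext h)⟩
    rw [this]
  · exact ((hF y).self_of_nhds y.2 hD).symm.trans (hy.1 y.2 hD)

variable [IsManifold 𝓘(ℂ, ℂ) ∞ X]

theorem contMDiffAt_chartAt (x : X) {y : X} (hy : y ∈ (chartAt ℂ x).source) :
    ContMDiffAt 𝓘(ℂ, ℂ) 𝓘(ℂ, ℂ) ∞ (chartAt ℂ x) y :=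
  contMDiffAt_of_mem_maximalAtlas (IsManifold.chart_mem_maximalAtlas x) hy

theorem exists_eq_coord_mul {p : X → ℂ} {x : X} (hp : ContMDiffAt 𝓘(ℂ, ℂ) 𝓘(ℂ, ℂ) ∞ p x)
    (h0 : p x = 0) : ∃ q : X → ℂ, ContMDiffAt 𝓘(ℂ, ℂ) 𝓘(ℂ, ℂ) ∞ q x ∧
      ∀ᶠ y in nhds x, p y = (chartAt ℂ x y - chartAt ℂ x x) * q y := by
  set c := chartAt ℂ x with hc
  have h1 : ContDiffAt ℂ ∞ (p ∘ c.symm) (c x) := by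
    have := (contMDiffAt_iff.mp hp).2
    simp only [extChartAt_model_space_eq_id, PartialEquiv.refl_coe, Function.id_comp,
      modelWithCornersSelf_coe, Set.range_id, contDiffWithinAt_univ] at this
    exact this
  obtain ⟨u, hu, hd⟩ : ∃ u ∈ nhds (c x), DifferentiableOn ℂ (p ∘ c.symm) u := by
    obtain ⟨u, hu, h⟩ := (h1.of_le (m := 1) (by simp)).contDiffOn (m := 1) le_rfl (by simp)
    exact ⟨u, by simpa using hu, h.differentiableOn (by simp)⟩
  -- Removable singularity theorem: the divided difference of a holomorphic function is holomorphic
  -- at the base point too.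
  have hslope : ContDiffAt ℂ ∞ (dslope (p ∘ c.symm) (c x)) (c x) :=
    (((Complex.differentiableOn_dslope hu).mpr hd).analyticAt hu).contDiffAt
  refine ⟨dslope (p ∘ c.symm) (c x) ∘ c, ?_, ?_⟩
  · exact (hslope.contMDiffAt).comp x (contMDiffAt_chartAt x (mem_chart_source ℂ x))
  · filter_upwards [c.open_source.mem_nhds (mem_chart_source ℂ x)] with y hy
    have := sub_smul_dslope (p ∘ c.symm) (c x) (c y)
    rw [smul_eq_mul] at this
    rw [Function.comp_apply, this, Function.comp_apply, Function.comp_apply, c.left_inv hy,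
      c.left_inv (mem_chart_source ℂ x), h0, sub_zero]

/-- At a point of `D`, `f = h / ℓ` and `p = ℓ q` for the same centred coordinate `ℓ`, so `f p`
extends as `h q`. Elsewhere the local equation is `1`. -/
theorem exists_holFun_eq_value_mul [T1Space X] {D : Finset X} {U V : Opens X} (hV : V ≤ U)
    (f : sec (OD D) U) (p : holFun V) (hp : ∀ y : V, y.1 ∈ D → p y = 0) :
    ∃ g : holFun V, ∀ (y : V) (hy : y.1 ∉ D), g y = value f ⟨y.1, hV y.2⟩ ⟨hy⟩ * p y := by
  refine exists_holFun_of_local D V (fun y hy => value f ⟨y.1, hV y.2⟩ ⟨hy⟩ * p y) fun x => ?_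
  classical
  obtain ⟨h, hh, hf⟩ := (show (poleData D).sections U from f).2 ⟨x.1, hV x.2⟩
  let P : X → ℂ := fun y => if hy : y ∈ V then p ⟨y, hy⟩ else 0
  have hPv : ∀ y (hy : y ∈ V), P y = p ⟨y, hy⟩ := fun y hy => by simp [P, hy]
  have hP : ContMDiffAt 𝓘(ℂ, ℂ) 𝓘(ℂ, ℂ) ∞ P x.1 :=
    contMDiffAt_of_eventuallyEq_holFun p x.2 (.of_forall hPv)
  by_cases hx : x.1 ∈ D
  · obtain ⟨q, hq, hPq⟩ := exists_eq_coord_mul hP ((hPv _ x.2).trans (hp x hx))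
    refine ⟨fun y => h y * q y, hh.mul hq, ?_⟩
    filter_upwards [hf, hPq] with y h1 h2 hy hD
    have h3 := h1 (hV hy) hD
    rw [localEq, if_pos hx] at h3
    rw [← hPv y hy, h2, ← h3]
    exact (mul_assoc _ _ _).symm
  · refine ⟨fun y => h y * P y, hh.mul hP, ?_⟩
    filter_upwards [hf] with y h1 hy hD
    have h3 := h1 (hV hy) hD
    rw [localEq, if_neg hx, mul_one] at h3
    rw [← hPv y hy, ← h3]
    rfl

end Holomorphic

open PrincipalBundle

/-! ### Holomorphic dual frames of the adjoint bundle -/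

section Frames

variable {n : ℕ} {F V : Type*} [NormedAddCommGroup F] [NormedSpace ℂ F]
  [NormedAddCommGroup V] [NormedSpace ℂ V]
  {G : Subgroup (GL (Fin n) ℂ)} [ChartedSpace V G]
  {X : Type} [TopologicalSpace X] [ChartedSpace ℂ X]
  {E : Type} [TopologicalSpace E] [ChartedSpace F E]
  {B : PrincipalBundle F V G X E}

theorem Ad_one (v : lieAlg G) : Ad G 1 v = v := Subtype.ext (by simp [Ad])

theorem Ad_mul (g h : G) (v : lieAlg G) : Ad G (g * h) v = Ad G g (Ad G h v) :=
  Subtype.ext (by simp [Ad, mul_assoc])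

namespace PrincipalBundle

/-- A family of elements of the fibers of the adjoint bundle is holomorphic. -/
abbrev IsHol {U : Opens X} (s : ∀ x : U, B.adFiber x.1) : Prop :=
  ContMDiff 𝓘(ℂ, F) 𝓘(ℂ, Fin n → Fin n → ℂ) ∞ (B.total (U := U) s)

/-- A holomorphic equivariant local trivialization. -/
structure IsHolTriv (e : Bundle.Trivialization G B.proj) : Prop where
  hol : ContMDiffOn 𝓘(ℂ, F) (𝓘(ℂ, ℂ).prod 𝓘(ℂ, V)) ∞ e e.source
  hol_symm : ContMDiffOn (𝓘(ℂ, ℂ).prod 𝓘(ℂ, V)) 𝓘(ℂ, F) ∞ e.toOpenPartialHomeomorph.symm e.target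
  equivariant : ∀ z ∈ e.source, ∀ g : G, e (B.act z g) = ((e z).1, (e z).2 * g)

variable (B) in
theorem exists_isHolTriv (x : X) :
    ∃ e : Bundle.Trivialization G B.proj, x ∈ e.baseSet ∧ IsHolTriv e := by
  obtain ⟨e, hx, h1, h2, h3⟩ := B.locally_trivial x
  exact ⟨e, hx, h1, h2, h3⟩

/-- The base set of a trivialization. -/
def baseOpen (e : Bundle.Trivialization G B.proj) : Opens X := ⟨e.baseSet, e.open_baseSet⟩

theorem IsHolTriv.mem_source (e : Bundle.Trivialization G B.proj) (y : baseOpen e)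
    (z : B.Fiber y.1) : z.1 ∈ e.source :=
  e.mem_source.mpr (z.2.symm ▸ y.2)

/-- The point of the fiber with coordinate `1`. -/
def basePoint (e : Bundle.Trivialization G B.proj) (y : baseOpen e) : B.Fiber y.1 :=
  ⟨e.toOpenPartialHomeomorph.symm (y.1, 1), e.proj_symm_apply' y.2⟩

theorem apply_basePoint (e : Bundle.Trivialization G B.proj) (y : baseOpen e) :
    e (basePoint e y).1 = (y.1, 1) :=
  e.apply_symm_apply' y.2

/-- The element of a fiber of the adjoint bundle with constant coordinate `v`. -/
def constVec {e : Bundle.Trivialization G B.proj} (he : IsHolTriv e) (v : lieAlg G)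
    (y : baseOpen e) : B.adFiber y.1 :=
  ⟨fun z => Ad G (e z.1).2⁻¹ v, fun z g => by
    change Ad G (e (B.act z.1 g)).2⁻¹ v = _
    rw [he.equivariant _ (IsHolTriv.mem_source e y z), mul_inv_rev, Ad_mul]⟩

theorem constVec_basePoint {e : Bundle.Trivialization G B.proj} (he : IsHolTriv e) (v : lieAlg G)
    (y : baseOpen e) : (constVec he v y).1 (basePoint e y) = v := by
  change Ad G (e (basePoint e y).1).2⁻¹ v = v
  rw [apply_basePoint, inv_one, Ad_one]

/-- Equivariance and transitivity of `G` on the fiber: evaluation at one point is injective. -/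
theorem adFiber_ext {x : X} {v w : B.adFiber x} (z : B.Fiber x) (h : v.1 z = w.1 z) : v = w := by
  refine Subtype.ext (funext fun z' => ?_)
  obtain ⟨g, rfl⟩ := B.exists_act_eq z z'
  rw [v.2, w.2, h]

/-- The entries of `Ad(g⁻¹) v` are polynomial in the entries of `g` and `g⁻¹`, which are holomorphic
on the Lie group `G` because it is a complex submanifold of the matrices. -/
theorem isHol_constVec [LieGroup 𝓘(ℂ, V) ∞ G] (hG : IsComplexSubmanifold V G)
    {e : Bundle.Trivialization G B.proj} (he : IsHolTriv e) (v : lieAlg G) :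
    IsHol (constVec he v) := by
  have h1 : ContMDiff 𝓘(ℂ, F) 𝓘(ℂ, V) ∞ (fun z : B.preimage (baseOpen e) => (e z.1).2) := by
    have h : ContMDiff 𝓘(ℂ, F) (𝓘(ℂ, ℂ).prod 𝓘(ℂ, V)) ∞
        (fun z : B.preimage (baseOpen e) => e z.1) :=
      he.hol.comp_contMDiff contMDiff_subtype_val fun z => e.mem_source.mpr z.2
    exact contMDiff_snd.comp h
  have h2 : ∀ i j, ContMDiff 𝓘(ℂ, V) 𝓘(ℂ, ℂ) ∞ (fun g : G => g.1.1 i j) := fun i j =>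
    contMDiff_pi_space.mp (contMDiff_pi_space.mp hG.1 i) j
  have h3 : ContMDiff 𝓘(ℂ, F) 𝓘(ℂ, V) ∞
      (fun z : B.preimage (baseOpen e) => (e z.1).2⁻¹) := h1.inv
  refine contMDiff_pi_space.mpr fun i => contMDiff_pi_space.mpr fun j => ?_
  have : ∀ z : B.preimage (baseOpen e), B.total (constVec he v) z i j =
      ∑ q : Fin n × Fin n, ((e z.1).2⁻¹).1.1 i q.1 * (((e z.1).2⁻¹)⁻¹).1.1 q.2 j * v.1 q.1 q.2 :=
    fun z => conj_entry _ _ _ _ _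
  simp_rw [this]
  refine contMDiff_finsetSum fun q _ => ?_
  exact (((h2 _ _).comp h3).mul ((h2 _ _).comp h3.inv)).mul contMDiff_const

/-- A bilinear form on the Lie algebra extends to a holomorphic function of pairs of matrices. -/
theorem exists_contDiff_extension (φ : LinearMap.BilinForm ℂ (lieAlg G)) :
    ∃ Φ : (Fin n → Fin n → ℂ) × (Fin n → Fin n → ℂ) → ℂ, ContDiff ℂ ∞ Φ ∧
      ∀ a b : lieAlg G, Φ ((a : Matrix (Fin n) (Fin n) ℂ), (b : Matrix (Fin n) (Fin n) ℂ)) = φ a b := by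
  -- Sections are holomorphic as matrix-valued functions, so the form is precomposed with a linear
  -- projection of all matrices onto the Lie algebra.
  obtain ⟨π, hπ⟩ := (lieAlg G).subtype.exists_leftInverse_of_injective
    (LinearMap.ker_eq_bot.mpr Subtype.val_injective)
  let ψ : (Fin n → Fin n → ℂ) →ₗ[ℂ] (Fin n → Fin n → ℂ) →ₗ[ℂ] ℂ := φ.compl₁₂ π π
  have hψ : ∀ a b : lieAlg G, ψ a.1 b.1 = φ a b := fun a b => by
    have h : ∀ c : lieAlg G, π c.1 = c := fun c => LinearMap.congr_fun hπ c
    change φ (π a.1) (π b.1) = _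
    rw [h, h]
  refine ⟨fun p => ψ p.1 p.2, ?_, hψ⟩
  let Ψ : (Fin n → Fin n → ℂ) →L[ℂ] (Fin n → Fin n → ℂ) →L[ℂ] ℂ :=
    LinearMap.toContinuousLinearMap (LinearMap.toContinuousLinearMap.toLinearMap ∘ₗ ψ)
  exact (Ψ.contDiff.comp contDiff_fst).clm_apply contDiff_snd

/-- By `hat_apply` the form may be computed at any point of the fiber of `E`; choosing the points
with coordinate `1` in a trivialization makes that choice holomorphic in `y`. -/
theorem exists_holFun_hat_of_le (σ : InvariantForm G) {e : Bundle.Trivialization G B.proj}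
    (he : IsHolTriv e) {U : Opens X} {s t : ∀ x : U, B.adFiber x.1} (hs : IsHol s)
    (ht : IsHol t) : ∃ g : holFun (U ⊓ baseOpen e), ∀ y, g y =
      hat σ y.1 (s ⟨y.1, y.2.1⟩) (t ⟨y.1, y.2.1⟩) := by
  obtain ⟨Φ, hΦ, hval⟩ := exists_contDiff_extension σ.form
  let pt : ↥(U ⊓ baseOpen e) → B.preimage U := fun y =>
    ⟨(basePoint e ⟨y.1, y.2.2⟩).1, by
      change B.proj _ ∈ U
      rw [(basePoint e ⟨y.1, y.2.2⟩).2]; exact y.2.1⟩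
  have hpt : ContMDiff 𝓘(ℂ, ℂ) 𝓘(ℂ, F) ∞ pt := by
    rw [← ContMDiff.subtypeVal_comp_iff]
    refine he.hol_symm.comp_contMDiff (f := fun y : ↥(U ⊓ baseOpen e) => (y.1, (1 : G)))
      (contMDiff_subtype_val.prodMk contMDiff_const) fun y => ?_
    exact e.mem_target.mpr y.2.2
  refine ⟨⟨fun y => Φ (B.total s (pt y), B.total t (pt y)), ?_⟩, fun y => ?_⟩
  · exact hΦ.contMDiff.comp ((hs.comp hpt).prodMk_space (ht.comp hpt))
  · change Φ (B.total s (pt y), B.total t (pt y)) = _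
    have hy : B.proj (basePoint e ⟨y.1, y.2.2⟩).1 = y.1 := (basePoint e ⟨y.1, y.2.2⟩).2
    have hev : ∀ (r : ∀ x : U, B.adFiber x.1), B.total r (pt y) =
        (((r ⟨y.1, y.2.1⟩).1 (basePoint e ⟨y.1, y.2.2⟩) : lieAlg G) : Matrix (Fin n) (Fin n) ℂ) := by
      intro r
      have : ∀ (x : X) (hx : x ∈ U) (z : B.Fiber x), ∀ hz : z.1 ∈ B.preimage U,
          B.total r ⟨z.1, hz⟩ = (((r ⟨x, hx⟩).1 z : lieAlg G) : Matrix (Fin n) (Fin n) ℂ) := by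
        rintro x hx ⟨z, rfl⟩ hz
        rfl
      exact this y.1 y.2.1 _ _
    rw [hev, hev, B.hat_apply σ _ _ (basePoint e ⟨y.1, y.2.2⟩)]
    exact hval _ _

theorem exists_holFun_hat (σ : InvariantForm G) {U : Opens X} {s t : ∀ x : U, B.adFiber x.1}
    (hs : IsHol s) (ht : IsHol t) :
    ∃ g : holFun U, ∀ y, g y = hat σ y.1 (s y) (t y) := by
  choose e hmem he using exists_isHolTriv B
  choose g hg using fun x => exists_holFun_hat_of_le σ (he x) hs ht
  obtain ⟨f, hf⟩ := holFun_glue (fun x => U ⊓ baseOpen (e x)) U (fun x => inf_le_left)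
    (fun y hy => Opens.mem_iSup.mpr ⟨y, hy, hmem y⟩) g
    (fun i j y hi hj => by rw [hg, hg])
  refine ⟨f, fun y => ?_⟩
  have := DFunLike.congr_fun (hf y.1) ⟨y.1, y.2, hmem y.1⟩
  rw [hg] at this
  exact this

theorem hat_symm (σ : InvariantForm G) {x : X} (v w : B.adFiber x) : hat σ x v w = hat σ x w v :=
  σ.symm _ _

/-- Near every point the adjoint bundle has a holomorphic frame `c` with a holomorphic dual
frame `b`. -/
theorem exists_frame [LieGroup 𝓘(ℂ, V) ∞ G] (hG : IsComplexSubmanifold V G)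
    (B : PrincipalBundle F V G X E) (σ : InvariantForm G) (x : X) :
    ∃ N : Opens X, x ∈ N ∧ ∃ (m : ℕ) (b c : Fin m → ∀ y : N, B.adFiber y.1),
      (∀ i, IsHol (b i)) ∧ (∀ i, IsHol (c i)) ∧
      ∀ (y : N) (v : B.adFiber y.1), v = ∑ i, hat σ y.1 v (b i y) • c i y := by
  obtain ⟨e, hx, he⟩ := exists_isHolTriv B x
  -- Constant frames suffice: at the base point the expansion becomes that of a Lie algebra element
  -- in the `σ`-dual basis `c` of `b`.
  let b := Module.finBasis ℂ (lieAlg G)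
  let c := σ.form.dualBasis σ.nondegenerate b
  refine ⟨baseOpen e, hx, _, fun i => constVec he (b i), fun i => constVec he (c i),
    fun i => isHol_constVec hG he _, fun i => isHol_constVec hG he _, fun y v => ?_⟩
  refine adFiber_ext (basePoint e y) ?_
  have h1 : (∑ i, hat σ y.1 v (constVec he (b i) y) • constVec he (c i) y).1 (basePoint e y) =
      ∑ i, hat σ y.1 v (constVec he (b i) y) • (constVec he (c i) y).1 (basePoint e y) := by
    simp
  rw [h1]
  simp_rw [B.hat_apply σ _ _ (basePoint e y), constVec_basePoint]
  conv_lhs => rw [← c.sum_repr (v.1 (basePoint e y))]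
  simp [c, LinearMap.BilinForm.dualBasis_repr_apply]

end PrincipalBundle

end Frames

/-! ### The pairing with values in the dual sheaf -/

section Pairing

variable {n : ℕ} {F V : Type*} [NormedAddCommGroup F] [NormedSpace ℂ F]
  [NormedAddCommGroup V] [NormedSpace ℂ V]
  {G : Subgroup (GL (Fin n) ℂ)} [ChartedSpace V G]
  {X : Type} [TopologicalSpace X] [ChartedSpace ℂ X]
  {E : Type} [TopologicalSpace E] [ChartedSpace F E]
  {B : PrincipalBundle F V G X E}
  {D : Finset X} (σ : InvariantForm G)
  {W W' : ∀ x : {x // x ∈ D}, Submodule ℂ (B.adFiber x.1)}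

namespace PrincipalBundle

theorem isHol_value {U : Opens X} (s : sec (B.adData D W).sheaf U) :
    IsHol (fun y : U => value s y) :=
  (show (B.adData D W).sections U from s).2.1

theorem value_mem {U : Opens X} (s : sec (B.adData D W).sheaf U) (x : {x // x ∈ D})
    (hx : x.1 ∈ U) : value s ⟨x.1, hx⟩ ∈ W x :=
  (show (B.adData D W).sections U from s).2.2 x hx

/-- A section of a sheaf of sections of the adjoint bundle. -/
def mkSec {U : Opens X} (s : ∀ y : U, B.adFiber y.1) (hs : IsHol s)
    (hW : ∀ (x : {x // x ∈ D}) (hx : x.1 ∈ U), s ⟨x.1, hx⟩ ∈ W x) : sec (B.adData D W).sheaf U :=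
  (show (B.adData D W).sections U from ⟨s, hs, hW⟩)

theorem value_mkSec {U : Opens X} (s : ∀ y : U, B.adFiber y.1) (hs : IsHol s)
    (hW : ∀ (x : {x // x ∈ D}) (hx : x.1 ∈ U), s ⟨x.1, hx⟩ ∈ W x) (y : U) :
    value (mkSec (W := W) s hs hW) y = s y := rfl

end PrincipalBundle

section Value

variable {T : X → Type} [∀ x, AddCommGroup (T x)] [∀ x, Module ℂ (T x)] {P : ModulePredicate T}

theorem value_add {U : Opens X} (s t : sec P.sheaf U) (y : U) :
    value (s + t) y = value s y + value t y := rfl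

theorem value_smul {U : Opens X} (f : holFun U) (s : sec P.sheaf U) (y : U) :
    value (f • s) y = f y • value s y := rfl

theorem value_secRes {U V : Opens X} (h : V ≤ U) (s : sec P.sheaf U) (y : V) :
    value (secRes P.sheaf h s) y = value s ⟨y.1, h y.2⟩ := rfl

theorem sec_ext {U : Opens X} {s t : sec P.sheaf U} (h : ∀ y, value s y = value t y) : s = t :=
  Subtype.ext (funext h)

theorem value_sum {U : Opens X} {ι : Type*} (I : Finset ι) (s : ι → sec P.sheaf U) (y : U) :
    value (∑ i ∈ I, s i) y = ∑ i ∈ I, value (s i) y :=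
  map_sum (⟨⟨fun s => value s y, rfl⟩, fun s t => value_add s t y⟩ : sec P.sheaf U →+ T y.1) s I

theorem dual_ext {M : OMod X} {U : Opens X} {l k : sec (dual M) U}
    (h : ∀ (V : Opens X) (hV : V ≤ U) (t : sec M V), dualEval l hV t = dualEval k hV t) : l = k :=
  Subtype.ext (funext fun V => LinearMap.ext fun t => h V.1 V.2 t)

theorem dualEval_secRes {M : OMod X} {U V V' : Opens X} (l : sec (dual M) U) (h : V ≤ U)
    (h' : V' ≤ V) (t : sec M V) :
    dualEval l (h'.trans h) (secRes M h' t) = holRes h' (dualEval l h t) :=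
  (show dualSections M U from l).2 ⟨V, h⟩ ⟨V', h'.trans h⟩ h' t

theorem dualEval_add {M : OMod X} {U V : Opens X} (l k : sec (dual M) U) (hV : V ≤ U)
    (t : sec M V) (y : V) : dualEval (l + k) hV t y = dualEval l hV t y + dualEval k hV t y := rfl

theorem dualEval_smul {M : OMod X} {U V : Opens X} (a : holFun U) (l : sec (dual M) U)
    (hV : V ≤ U) (t : sec M V) (y : V) :
    dualEval (a • l) hV t y = a ⟨y.1, hV y.2⟩ * dualEval l hV t y := rfl

end Value

/-- The product of a section of the adjoint bundle with a function that vanishes on `D`. -/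
def smulSec {U : Opens X} (ℓ : holFun U) (hℓ : ∀ y : U, y.1 ∈ D → ℓ y = 0)
    (s : sec (B.adData ∅ fun _ => ⊤).sheaf U) : sec (B.adData D W).sheaf U :=
  mkSec (fun y => ℓ y • value s y) (isHol_value (ℓ • s)) fun x hx => by
    rw [hℓ ⟨x.1, hx⟩ x.2, zero_smul]; exact (W x).zero_mem

theorem value_smulSec {U : Opens X} (ℓ : holFun U) (hℓ : ∀ y : U, y.1 ∈ D → ℓ y = 0)
    (s : sec (B.adData ∅ fun _ => ⊤).sheaf U) (y : U) :
    value (smulSec (W := W) ℓ hℓ s) y = ℓ y • value s y := rfl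

variable [T1Space X]

theorem dual_ext_of_notMem {M : OMod X} {U : Opens X} {l k : sec (dual M) U}
    (h : ∀ (V : Opens X) (hV : V ≤ U) (t : sec M V) (y : V), y.1 ∉ D →
      dualEval l hV t y = dualEval k hV t y) : l = k :=
  dual_ext fun V hV t => holFun_ext_of_notMem (D := D) (h V hV t)

variable [IsManifold 𝓘(ℂ, ℂ) ∞ X]

/-- `W` and `W'` are orthogonal to each other. -/
def Perp (W W' : ∀ x : {x // x ∈ D}, Submodule ℂ (B.adFiber x.1)) : Prop :=
  ∀ x, ∀ v ∈ W' x, ∀ w ∈ W x, hat σ x.1 v w = 0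

variable {σ}

/-- Orthogonality makes `σ(s, t)` vanish on `D`, which absorbs the pole of `f`. -/
theorem exists_pairing (h : Perp σ W W') {U U' : Opens X} (hU : U' ≤ U)
    (s : sec (B.adData D W').sheaf U) (f : sec (OD D) U) (t : sec (B.adData D W).sheaf U') :
    ∃ g : holFun U', ∀ (y : U') (hy : y.1 ∉ D), g y =
      value f ⟨y.1, hU y.2⟩ ⟨hy⟩ * hat σ y.1 (value s ⟨y.1, hU y.2⟩) (value t y) := by
  obtain ⟨p, hp⟩ := exists_holFun_hat σ (isHol_value (secRes _ hU s)) (isHol_value t)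
  obtain ⟨g, hg⟩ := exists_holFun_eq_value_mul hU f p fun y hy => by
    rw [hp]
    exact h ⟨y.1, hy⟩ _ (value_mem _ ⟨y.1, hy⟩ y.2) _ (value_mem t ⟨y.1, hy⟩ y.2)
  exact ⟨g, fun y hy => by rw [hg y hy, hp]; rfl⟩

/-- The holomorphic function that extends `f σ(s, t)`. -/
def pairFun (h : Perp σ W W') {U U' : Opens X} (hU : U' ≤ U)
    (s : sec (B.adData D W').sheaf U) (f : sec (OD D) U) (t : sec (B.adData D W).sheaf U') :
    holFun U' := (exists_pairing h hU s f t).choose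

theorem pairFun_apply (h : Perp σ W W') {U U' : Opens X} (hU : U' ≤ U)
    (s : sec (B.adData D W').sheaf U) (f : sec (OD D) U) (t : sec (B.adData D W).sheaf U')
    (y : U') (hy : y.1 ∉ D) : pairFun h hU s f t y =
      value f ⟨y.1, hU y.2⟩ ⟨hy⟩ * hat σ y.1 (value s ⟨y.1, hU y.2⟩) (value t y) :=
  (exists_pairing h hU s f t).choose_spec y hy

/-- The section `t ↦ f σ(s, t)` of the dual sheaf. -/
def pairDual (h : Perp σ W W') {U : Opens X} (s : sec (B.adData D W').sheaf U)
    (f : sec (OD D) U) : sec (dual (B.adData D W).sheaf) U :=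
  (show dualSections (B.adData D W).sheaf U from
    ⟨fun U' =>
      { toFun := pairFun h U'.2 s f
        map_add' := fun t t' => holFun_ext_of_notMem (D := D) fun y hy => by
          rw [ContMDiffMap.coe_add, Pi.add_apply]
          simp only [pairFun_apply h _ _ _ _ _ hy, value_add, map_add, mul_add]
        map_smul' := fun a t => holFun_ext_of_notMem (D := D) fun y hy => by
          change _ = a y * pairFun h U'.2 s f t y
          simp only [pairFun_apply h _ _ _ _ _ hy, value_smul, map_smul, smul_eq_mul]
          ring },
    fun V V' hV t => holFun_ext_of_notMem (D := D) fun y hy => by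
      change pairFun h V'.2 s f _ y = pairFun h V.2 s f t ⟨y.1, hV y.2⟩
      rw [pairFun_apply h _ _ _ _ _ hy, pairFun_apply h V.2 s f t ⟨y.1, hV y.2⟩ hy]
      rfl⟩)

theorem dualEval_pairDual (h : Perp σ W W') {U U' : Opens X} (hU : U' ≤ U)
    (s : sec (B.adData D W').sheaf U) (f : sec (OD D) U) (t : sec (B.adData D W).sheaf U')
    (y : U') (hy : y.1 ∉ D) : dualEval (pairDual h s f) hU t y =
      value f ⟨y.1, hU y.2⟩ ⟨hy⟩ * hat σ y.1 (value s ⟨y.1, hU y.2⟩) (value t y) :=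
  pairFun_apply h hU s f t y hy

/-- The pairing of `W'`-sections with sections of `𝒪(D)`, with values in the dual sheaf. -/
def pairing (h : Perp σ W W') (U : Opens X) : sec (B.adData D W').sheaf U →ₗ[holFun U]
    sec (OD D) U →ₗ[holFun U] sec (dual (B.adData D W).sheaf) U :=
  LinearMap.mk₂ (holFun U) (pairDual h)
    (fun s s' f => dual_ext_of_notMem (D := D) fun V hV t y hy => by
      simp only [dualEval_add, dualEval_pairDual h hV _ _ t y hy, value_add, map_add,
        LinearMap.add_apply, mul_add])
    (fun a s f => dual_ext_of_notMem (D := D) fun V hV t y hy => by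
      simp only [dualEval_smul, dualEval_pairDual h hV _ _ t y hy, value_smul, map_smul,
        LinearMap.smul_apply, smul_eq_mul]
      ring)
    (fun s f f' => dual_ext_of_notMem (D := D) fun V hV t y hy => by
      rw [dualEval_add]
      simp only [dualEval_pairDual h hV _ _ t y hy]
      exact add_mul _ _ _)
    (fun a s f => dual_ext_of_notMem (D := D) fun V hV t y hy => by
      rw [dualEval_smul]
      simp only [dualEval_pairDual h hV _ _ t y hy]
      exact mul_assoc _ _ _)

theorem secRes_pairing (h : Perp σ W W') {U V : Opens X} (hV : V ≤ U)
    (s : sec (B.adData D W').sheaf U) (f : sec (OD D) U) :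
    secRes _ hV (pairing h U s f) = pairing h V (secRes _ hV s) (secRes _ hV f) :=
  dual_ext_of_notMem (D := D) fun _ hV' t y hy =>
    (dualEval_pairDual h (hV'.trans hV) s f t y hy).trans
      (dualEval_pairDual h hV' (secRes _ hV s) (secRes _ hV f) t y hy).symm

end Pairing

/-! ### Local generators of `𝒪(D)` -/

section Coordinate

variable {X : Type} [TopologicalSpace X] [T1Space X] [ChartedSpace ℂ X] [IsManifold 𝓘(ℂ, ℂ) ∞ X]

/-- Near every point the divisor `D` has an equation `ℓ`, and `1 / ℓ` generates `𝒪(D)`. -/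
theorem exists_generator_OD (D : Finset X) (U : Opens X) {x : X} (hx : x ∈ U) :
    ∃ V ≤ U, x ∈ V ∧ (∀ y ∈ V, y ∈ D → y = x) ∧ ∃ (ℓ : holFun V) (f₀ : sec (OD D) V),
      (∀ y : V, y.1 ∈ D → ℓ y = 0) ∧
      (∀ (y : V) (hy : y.1 ∉ D), value f₀ y ⟨hy⟩ * ℓ y = 1) ∧
      ∀ f : sec (OD D) V, ∃ h : holFun V, f = h • f₀ := by
  have hfin : IsOpen ((D : Set X) \ {x})ᶜ :=
    (D.finite_toSet.subset Set.sdiff_subset).isClosed.isOpen_compl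
  -- Removing the other points of `D` and staying in the chart makes `localEq D x` vanish exactly on
  -- `D ∩ V`, which is contained in `{x}`.
  let V : Opens X := ⟨U ∩ ((chartAt ℂ x).source ∩ ((D : Set X) \ {x})ᶜ),
    U.isOpen.inter ((chartAt ℂ x).open_source.inter hfin)⟩
  have hVD : ∀ y ∈ V, y ∈ D → y = x := fun y hy hD => by
    by_contra hne
    exact hy.2.2 ⟨hD, hne⟩
  have hV : V ≤ U := fun y hy => hy.1
  have hol : ∀ y ∈ V, ContMDiffAt 𝓘(ℂ, ℂ) 𝓘(ℂ, ℂ) ∞ (localEq D x) y := fun y hy => by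
    by_cases hxD : x ∈ D
    · have : localEq D x = fun y => chartAt ℂ x y - chartAt ℂ x x := by
        funext y; rw [localEq, if_pos hxD]
      rw [this]
      exact (contMDiffAt_chartAt x hy.2.1).sub contMDiffAt_const
    · have : localEq D x = fun y => 1 := by
        funext y; rw [localEq, if_neg hxD]
      rw [this]
      exact contMDiffAt_const
  have hne : ∀ y ∈ V, y ∉ D → localEq D x y ≠ 0 := fun y hy hyD => by
    by_cases hxD : x ∈ D
    · rw [localEq, if_pos hxD, sub_ne_zero]
      intro heq
      exact hyD ((chartAt ℂ x).injOn hy.2.1 (mem_chart_source ℂ x) heq ▸ hxD)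
    · rw [localEq, if_neg hxD]
      exact one_ne_zero
  have hzero : ∀ y ∈ V, y ∈ D → localEq D x y = 0 := fun y hy hyD => by
    obtain rfl := hVD y hy hyD
    rw [localEq, if_pos hyD, sub_self]
  let ℓ : holFun V := ⟨fun y => localEq D x y.1, fun y => contMDiffAt_subtype_iff.mpr (hol y.1 y.2)⟩
  have hf₀ : (poleData D).pred (U := V) (fun y _ => (localEq D x y.1)⁻¹) := fun y => by
    by_cases hyD : y.1 ∈ D
    · refine ⟨fun _ => 1, contMDiffAt_const, .of_forall fun z hz hzD => ?_⟩
      rw [hVD y.1 y.2 hyD]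
      exact inv_mul_cancel₀ (hne z hz hzD)
    · refine ⟨fun z => (localEq D x z)⁻¹, (hol y.1 y.2).inv₀ (hne y.1 y.2 hyD),
        .of_forall fun z hz hzD => ?_⟩
      rw [localEq, if_neg hyD, mul_one]
  let f₀ : sec (OD D) V := (show (poleData D).sections V from ⟨fun y _ => (localEq D x y.1)⁻¹, hf₀⟩)
  have hmul : ∀ (y : V) (hy : y.1 ∉ D), value f₀ y ⟨hy⟩ * ℓ y = 1 := fun y hy =>
    inv_mul_cancel₀ (hne y.1 y.2 hy)
  refine ⟨V, hV, ⟨hx, mem_chart_source ℂ x, fun h => h.2 rfl⟩, hVD, ℓ, f₀,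
    fun y hy => hzero y.1 y.2 hy, hmul, fun f => ?_⟩
  -- The coefficient of `f` on `f₀ = 1/ℓ` is `f ℓ`, which extends over `D` since `ℓ` vanishes there.
  obtain ⟨h, hh⟩ := exists_holFun_eq_value_mul le_rfl f ℓ fun y hy => hzero y.1 y.2 hy
  refine ⟨h, sec_ext fun y => funext fun ⟨hy⟩ => ?_⟩
  change value f y ⟨hy⟩ = h y * value f₀ y ⟨hy⟩
  rw [hh y hy, mul_assoc, mul_comm (ℓ y), hmul, mul_one]

end Coordinate

/-! ### Local bijectivity of the pairing -/

section Duality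

variable {n : ℕ} {F V : Type*} [NormedAddCommGroup F] [NormedSpace ℂ F]
  [NormedAddCommGroup V] [NormedSpace ℂ V]
  {G : Subgroup (GL (Fin n) ℂ)} [ChartedSpace V G] [LieGroup 𝓘(ℂ, V) ∞ G]
  {X : Type} [TopologicalSpace X] [T1Space X] [ChartedSpace ℂ X] [IsManifold 𝓘(ℂ, ℂ) ∞ X]
  {E : Type} [TopologicalSpace E] [ChartedSpace F E]
  {B : PrincipalBundle F V G X E}
  {D : Finset X} {σ : InvariantForm G}
  {W W' : ∀ x : {x // x ∈ D}, Submodule ℂ (B.adFiber x.1)}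

/-- On small open sets there are a local equation of `D` and dual frames of the adjoint bundle. -/
theorem exists_frame_generator (hG : IsComplexSubmanifold V G) (B : PrincipalBundle F V G X E)
    (D : Finset X) (σ : InvariantForm G) (U : Opens X) {x : X} (hx : x ∈ U) :
    ∃ N ≤ U, x ∈ N ∧ (∀ y ∈ N, y ∈ D → y = x) ∧ ∃ (ℓ : holFun N) (f₀ : sec (OD D) N),
      (∀ y : N, y.1 ∈ D → ℓ y = 0) ∧
      (∀ (y : N) (hy : y.1 ∉ D), value f₀ y ⟨hy⟩ * ℓ y = 1) ∧
      (∀ f : sec (OD D) N, ∃ h : holFun N, f = h • f₀) ∧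
      ∃ (m : ℕ) (b c : Fin m → sec (B.adData ∅ fun _ => ⊤).sheaf N),
      ∀ (y : N) (v : B.adFiber y.1), v = ∑ i, hat σ y.1 v (value (b i) y) • value (c i) y := by
  obtain ⟨N₀, hxN, m, b, c, hb, hc, hbc⟩ := exists_frame hG B σ x
  obtain ⟨N, hN, hxN', hND, ℓ, f₀, h1, h2, h3⟩ := exists_generator_OD D (U ⊓ N₀) ⟨hx, hxN⟩
  have hN₀ : N ≤ N₀ := hN.trans inf_le_right
  exact ⟨N, hN.trans inf_le_left, hxN', hND, ℓ, f₀, h1, h2, h3, m,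
    fun i => secRes _ hN₀ (mkSec (b i) (hb i) fun _ _ => trivial),
    fun i => secRes _ hN₀ (mkSec (c i) (hc i) fun _ _ => trivial), fun y v => hbc ⟨y.1, hN₀ y.2⟩ v⟩

theorem pairing_locally_injective (hG : IsComplexSubmanifold V G) (h : Perp σ W W')
    (U : Opens X) : ∀ x ∈ U, ∃ N ≤ U, x ∈ N ∧ ∃ f₀ : sec (OD D) N,
      (∀ f : sec (OD D) N, ∃ a : holFun N, f = a • f₀) ∧
        ∀ s : sec (B.adData D W').sheaf N, pairing h N s f₀ = 0 → s = 0 := by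
  intro x hx
  obtain ⟨N, hN, hxN, -, ℓ, f₀, hℓ, hf₀, hgen, m, b, c, hbc⟩ :=
    exists_frame_generator hG B D σ U hx
  refine ⟨N, hN, hxN, f₀, hgen, fun s hs => sec_ext fun y => ?_⟩
  have key : ∀ i, hat σ y.1 (value s y) (value (b i) y) = 0 := fun i => by
    obtain ⟨g, hg⟩ := exists_holFun_hat σ (isHol_value s) (isHol_value (b i))
    -- The test section `ℓ b i` is admissible whatever `W` is, and off `D` the factor `ℓ` cancels
    -- `f₀`, leaving `σ(s, b i)`.
    have hg0 : g = 0 := holFun_ext_of_notMem (D := D) fun z hz => by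
      have h1 := dualEval_pairDual h le_rfl s f₀ (smulSec ℓ hℓ (b i)) z hz
      have h2 : dualEval (pairDual h s f₀) le_rfl (smulSec ℓ hℓ (b i)) z = 0 :=
        DFunLike.congr_fun (congrArg (fun l => dualEval l le_rfl (smulSec ℓ hℓ (b i))) hs) z
      rw [h2, value_smulSec, map_smul, smul_eq_mul, ← mul_assoc, hf₀, one_mul] at h1
      rw [hg, ← h1]
      rfl
    rw [← hg, hg0]
    rfl
  rw [hbc y (value s y)]
  simp_rw [key, zero_smul, Finset.sum_const_zero]
  rfl

theorem pairing_locally_surjective (hG : IsComplexSubmanifold V G) (h : Perp σ W W')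
    (hW' : ∀ x v, (∀ w ∈ W x, hat σ x.1 v w = 0) → v ∈ W' x)
    (U : Opens X) (k : sec (dual (B.adData D W).sheaf) U) :
    ∀ x ∈ U, ∃ (N : Opens X) (hN : N ≤ U), x ∈ N ∧
      ∃ (s : sec (B.adData D W').sheaf N) (f : sec (OD D) N), pairing h N s f = secRes _ hN k := by
  intro x hx
  obtain ⟨N, hN, hxN, hND, ℓ, f₀, hℓ, hf₀, -, m, b, c, hbc⟩ :=
    exists_frame_generator hG B D σ U hx
  -- The functional `k` need not be defined on `c i`, only on `ℓ c i`. The section `s₀` built from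
  -- these values represents `ℓ k`, not `k`.
  let a : Fin m → holFun N := fun i => dualEval k hN (smulSec ℓ hℓ (c i))
  let s₀ : sec (B.adData ∅ fun _ => ⊤).sheaf N := ∑ i, a i • b i
  have hs₀ : ∀ y, value s₀ y = ∑ i, a i y • value (b i) y := fun y => value_sum _ _ y
  have key : ∀ (N' : Opens X) (hN' : N' ≤ N) (t : sec (B.adData D W).sheaf N') (y : N'),
      hat σ y.1 (value s₀ ⟨y.1, hN' y.2⟩) (value t y) =
        ℓ ⟨y.1, hN' y.2⟩ * dualEval k (hN'.trans hN) t y := by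
    intro N' hN' t y
    choose g hg using fun i => exists_holFun_hat σ (isHol_value t)
      (isHol_value (secRes _ hN' (b i)))
    have hexp : holRes hN' ℓ • t =
        ∑ i, g i • secRes _ hN' (smulSec (W := W) ℓ hℓ (c i)) := sec_ext fun z => by
      rw [value_smul, value_sum, hbc ⟨z.1, hN' z.2⟩ (value t z), Finset.smul_sum]
      refine Finset.sum_congr rfl fun i _ => ?_
      rw [value_smul, hg, value_secRes, value_secRes, value_smulSec, smul_comm]
      rfl
    have h1 := congrArg (fun r => dualEval k (hN'.trans hN) r y) hexp
    simp only [map_smul, map_sum, dualEval_secRes k hN hN'] at h1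
    have h2 : ∀ r : Fin m → holFun N', (∑ i, r i) y = ∑ i, r i y := fun r =>
      map_sum (ContMDiffMap.evalRingHom y) r _
    rw [h2] at h1
    refine Eq.trans ?_ h1.symm
    rw [hs₀, map_sum, LinearMap.sum_apply]
    refine Finset.sum_congr rfl fun i _ => ?_
    rw [map_smul, LinearMap.smul_apply]
    change a i ⟨y.1, hN' y.2⟩ * _ = g i y * a i ⟨y.1, hN' y.2⟩
    rw [hg, mul_comm]
    congr 1
    exact hat_symm σ _ _
  have hs : ∀ (z : {z // z ∈ D}) (hz : z.1 ∈ N), value s₀ ⟨z.1, hz⟩ ∈ W' z := by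
    intro z hz
    refine hW' z _ fun w hw => ?_
    -- Constant coefficients extend `w` to a section of `ad(E)` with value `w` at `z`. It is a
    -- `W`-section because `N` contains no other point of `D`, so it can be tested in `key`, where
    -- `ℓ` vanishes at `z`.
    let t₀ : sec (B.adData ∅ fun _ => ⊤).sheaf N :=
      ∑ i, (ContMDiffMap.const (hat σ z.1 w (value (b i) ⟨z.1, hz⟩)) : holFun N) • c i
    have ht₀ : value t₀ ⟨z.1, hz⟩ = w :=
      (value_sum _ _ _).trans (hbc ⟨z.1, hz⟩ w).symm
    let t : sec (B.adData D W).sheaf N := mkSec (value t₀) (isHol_value t₀) fun z' hz' => by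
      obtain rfl : z' = z := Subtype.ext ((hND _ hz' z'.2).trans (hND _ hz z.2).symm)
      rw [ht₀]; exact hw
    have := key N le_rfl t ⟨z.1, hz⟩
    rw [hℓ _ z.2, zero_mul] at this
    rw [← ht₀]
    exact this
  refine ⟨N, hN, hxN, mkSec (value s₀) (isHol_value s₀) hs, f₀,
    dual_ext_of_notMem (D := D) fun N' hN' t y hy => ?_⟩
  refine (dualEval_pairDual h hN' _ f₀ t y hy).trans ?_
  rw [value_mkSec, key N' hN' t y, ← mul_assoc, hf₀ ⟨y.1, hN' y.2⟩ hy, one_mul]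
  rfl

/-- If `W` and `W'` are the annihilators of each other, the invariant form induces a unique
isomorphism from the twist of the sheaf of sections with values in `W'` to the dual of the sheaf
of sections with values in `W`. -/
theorem existsUnique_duality_iso (hG : IsComplexSubmanifold V G)
    (hW : ∀ x v, v ∈ W' x ↔ ∀ w ∈ W x, hat σ x.1 v w = 0) :
    ∃! S : tensor (B.adData D W').sheaf (OD D) ≅ dual (B.adData D W).sheaf,
      ∀ (U N : Opens X) (hN : N ≤ U) (s : sec (B.adData D W').sheaf U) (f : sec (OD D) U)
        (t : sec (B.adData D W).sheaf N) (y : N) (hy : y.1 ∉ D),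
        dualEval (onSec S.hom (tmul s f)) hN t y =
          value f ⟨y.1, hN y.2⟩ ⟨hy⟩ * hat σ y.1 (value s ⟨y.1, hN y.2⟩) (value t y) := by
  have h : Perp σ W W' := fun x v hv w hw => (hW x v).mp hv w hw
  -- The formula off `D` determines the dual section, so it is equivalent to prescribing `S` on `s ⊗
  -- f` as `pairing h`.
  refine (existsUnique_congr fun S => ?_).mp (existsUnique_tensor_iso (pairing h)
    (fun hV s f => secRes_pairing h hV s f) (pairing_locally_injective hG h)
    (pairing_locally_surjective hG h fun x v => (hW x v).mpr))
  constructor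
  · intro hS U N hN s f t y hy
    rw [hS]
    exact dualEval_pairDual h hN s f t y hy
  · intro hS U s f
    exact dual_ext_of_notMem (D := D) fun N hN t y hy =>
      (hS U N hN s f t y hy).trans (dualEval_pairDual h hN s f t y hy).symm

end Duality

/-! ### Biorthogonality in a fiber of the adjoint bundle -/

section Orthogonal

variable {n : ℕ} {F V : Type*} [NormedAddCommGroup F] [NormedSpace ℂ F]
  [NormedAddCommGroup V] [NormedSpace ℂ V]
  {G : Subgroup (GL (Fin n) ℂ)} [ChartedSpace V G]
  {X : Type} [TopologicalSpace X] [ChartedSpace ℂ X]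
  {E : Type} [TopologicalSpace E] [ChartedSpace F E]
  {B : PrincipalBundle F V G X E} (σ : InvariantForm G) {x : X}

theorem mem_orthogonal_hat_iff {W : Submodule ℂ (B.adFiber x)} {v : B.adFiber x} :
    v ∈ (hat σ x).orthogonal W ↔ ∀ w ∈ W, hat σ x v w = 0 := by
  refine (LinearMap.BilinForm.mem_orthogonal_iff).trans (forall₂_congr fun w _ => ?_)
  rw [hat_symm]

/-- Evaluation at the base point embeds the fiber in the Lie algebra, hence finite dimension; the
vectors `constVec` realize every value there, hence nondegeneracy is inherited from `σ`. -/
theorem orthogonal_orthogonal_hat (W : Submodule ℂ (B.adFiber x)) :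
    (hat σ x).orthogonal ((hat σ x).orthogonal W) = W := by
  obtain ⟨e, hx, he⟩ := exists_isHolTriv B x
  let y : baseOpen e := ⟨x, hx⟩
  let ev : B.adFiber x →ₗ[ℂ] lieAlg G := LinearMap.proj (basePoint e y) ∘ₗ (B.adFiber x).subtype
  have : FiniteDimensional ℂ (B.adFiber x) :=
    FiniteDimensional.of_injective ev fun v w h => adFiber_ext (basePoint e y) h
  have hrefl : (hat (B := B) σ x).IsRefl := fun v w h => (hat_symm σ w v).trans h
  have hsep : ∀ v : B.adFiber x, (∀ w, hat σ x v w = 0) → v = 0 := fun v hv => by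
    refine adFiber_ext (basePoint e y) (σ.nondegenerate.1 _ fun a => ?_)
    have := hv (constVec he a y)
    rwa [B.hat_apply σ _ _ (basePoint e y), constVec_basePoint] at this
  have hnd : (hat (B := B) σ x).Nondegenerate :=
    ⟨hsep, fun v hv => hsep v fun w => (hat_symm σ v w).trans (hv w)⟩
  exact @LinearMap.BilinForm.orthogonal_orthogonal (B.adFiber x) ℂ _ _ _ _ (hat σ x) hnd hrefl W

end Orthogonal

end FramedBundle

end

open FramedBundle FramedBundle.PrincipalBundle in
theorem mainTheorem10
    -- a compact connected Riemann surface `X` and a reduced effective divisor `D ≠ 0`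
    {X : Type} [TopologicalSpace X] [T2Space X] [CompactSpace X] [ConnectedSpace X]
    [ChartedSpace ℂ X] [IsManifold 𝓘(ℂ, ℂ) ∞ X]
    (D : Finset X) (hD : D.Nonempty)
    -- a connected complex reductive affine algebraic group `G`
    {n : ℕ} (G : Subgroup (GL (Fin n) ℂ)) [ConnectedSpace G]
    (hGclosed : IsZariskiClosed (G : Set (GL (Fin n) ℂ))) (hGred : IsReductive G)
    {V : Type*} [NormedAddCommGroup V] [NormedSpace ℂ V]
    [ChartedSpace V G] [LieGroup 𝓘(ℂ, V) ∞ G] (hG : IsComplexSubmanifold V G)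
    -- a nondegenerate symmetric invariant bilinear form on its Lie algebra
    (σ : InvariantForm G)
    -- proper Zariski closed subgroups `H_x`, for `x ∈ D`
    (H : {x // x ∈ D} → Subgroup G) (hHclosed : ∀ x, IsZariskiClosedSubgroup (H x))
    (hHproper : ∀ x, H x ≠ ⊤)
    -- a holomorphic principal `G`-bundle with a framing over `D`
    {E : Type} [TopologicalSpace E]
    {F : Type*} [NormedAddCommGroup F] [NormedSpace ℂ F]
    [ChartedSpace F E] [IsManifold 𝓘(ℂ, F) ∞ E]
    (B : PrincipalBundle F V G X E) (φ : B.Framing D H) :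
    (∃! S : tensor (B.adFramedPerp φ σ) (OD D) ≅ dual (B.adFramed φ),
      ∀ (U W : Opens X) (hW : W ≤ U) (s : sec (B.adFramedPerp φ σ) U) (f : sec (OD D) U)
        (t : sec (B.adFramed φ) W) (y : W) (hy : y.1 ∉ D),
        dualEval (onSec S.hom (tmul s f)) hW t y =
          value f ⟨y.1, hW y.2⟩ ⟨hy⟩ * hat σ y.1 (value s ⟨y.1, hW y.2⟩) (value t y)) ∧
    (∃! S : tensor (B.adFramed φ) (OD D) ≅ dual (B.adFramedPerp φ σ),
      ∀ (U W : Opens X) (hW : W ≤ U) (s : sec (B.adFramed φ) U) (f : sec (OD D) U)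
        (t : sec (B.adFramedPerp φ σ) W) (y : W) (hy : y.1 ∉ D),
        dualEval (onSec S.hom (tmul s f)) hW t y =
          value f ⟨y.1, hW y.2⟩ ⟨hy⟩ * hat σ y.1 (value s ⟨y.1, hW y.2⟩) (value t y)) := by
  have h₁ : ∀ x v, v ∈ B.framingPerp φ σ x ↔ ∀ w ∈ B.framingSubspace φ x, hat σ x.1 v w = 0 :=
    fun x v => mem_orthogonal_hat_iff σ
  -- The second use has `W = ℋ^⊥` and `W' = ℋ`, so its hypothesis is `ℋ = ℋ^⊥⊥`.
  refine ⟨existsUnique_duality_iso hG h₁, existsUnique_duality_iso hG fun x v => ?_⟩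
  rw [← mem_orthogonal_hat_iff σ]
  change _ ↔ v ∈ (hat σ x.1).orthogonal ((hat σ x.1).orthogonal (B.framingSubspace φ x))
  rw [orthogonal_orthogonal_hat]
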